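/- Let $N\ge 1$, let $e_1,\dots,e_N\in\mathbb{R}^2$ be distinct unit vectors, and put $J_i^*=(0,\infty)e_i$, $J=\bigcup_{i}[0,\infty)e_i$ and $J_T=(0,T)\times J$, where $T>0$. Let $\gamma>0$ and let $L_1,\dots,L_N\in C^2(\mathbb{R})$ satisfy $L_i''\ge\gamma$. Put $$H_i(p)=\sup_{q\in\mathbb{R}}\,(pq-L_i(q)),\qquad H_i^-(p)=\sup_{q\le 0}\,(pq-L_i(q)),\qquad L_0(p)=\min_j L_j(p).$$ Let $u_0:J\to\mathbb{R}$ be Lipschitz continuous. Definitions. The space $C^1_*(J_T)$ consists of the continuous functions $\phi$ on $J_T$ such that, for every $i$, $(t,r)\mapsto\phi(t,re_i)$ is $C^1$ on $(0,T)\times[0,\infty)$; its derivative in $r$ (one-sided at $r=0$) is denoted by $\phi^i_x$. A function $u:[0,T)\times J\to\mathbb{R}$ is a sub-solution of the junction problem if it is upper semi-continuous, $u(0,\cdot)\le u_0$, and for every $\phi\in C^1_*(J_T)$ with $u\le\phi$ in a neighbourhood in $J_T$ of a point $(t,x)\in J_T$ and $u(t,x)=\phi(t,x)$, one has $$\phi_t(t,x)+H_i(\phi^i_x(t,x))\le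 0\ \text{ if } x\in J_i^*,\qquad \phi_t(t,0)+\max_i H_i^-(\phi^i_x(t,0))\le 0\ \text{ if } x=0.$$ For $t\ge 0$ and $x\in J$ let $$u_{\mathrm{oc}}(t,x)=\inf\Big\{u_0(X(0))+\int_0^t L(X(\tau),\dot X(\tau))\,d\tau\Big\},$$ where the infimum is over all $X\in W^{1,1}([0,t];\mathbb{R}^2)$ with values in $J$, with $X(t)=x$, and such that for a.e. $\tau$ one has $\dot X(\tau)\in\mathbb{R}e_i$ if $X(\tau)\in J_i^*$ and $\dot X(\tau)\in\bigcup_i[0,\infty)e_i$ if $X(\tau)=0$. Here $L(x,pe_i)=L_i(p)$ if $x\in J_i^*$ and $L(0,pe_i)=L_0(p)$ for $p\ge0$; a trajectory whose running cost is not integrable has cost $+\infty$. Let $\mathcal{S}$ be the set of all continuous $u:[0,T)\times J\to\mathbb{R}$ with $u(0,\cdot)=u_0$ such that, for each $i$, the function $u^i(t,r)=u(t,re_i)$ is a viscosity solution (with $C^1$ test functions) of $u^i_t+H_i(u^i_r)=0$ on $(0,T)\times(0,\infty)$; no condition is imposed at the junction point. Theorem. Every $u\in\mathcal{S}$ is a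 sub-solution of the junction problem and satisfies $u\le u_{\mathrm{oc}}$ on $[0,T)\times J$. Moreover $u_{\mathrm{oc}}$ is finite on $[0,T)\times J$ and belongs to $\mathcal{S}$; hence it is the greatest element of $\mathcal{S}$. -/

import Mathlib

open Set Filter Topology MeasureTheory

namespace JunctionHJ

noncomputable section

/-- The Euclidean plane, in which the junction is embedded. -/
abbrev Plane := EuclideanSpace ℝ (Fin 2)

/-- The open branch `J_i^* = (0,∞)·e_i`. -/
def openBranch {N : ℕ} (e : Fin N → Plane) (i : Fin N) : Set Plane :=
  {x | ∃ r : ℝ, 0 < r ∧ x = r • e i}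

/-- The junction `J`, the union of the half-lines `[0,∞)·e_i`. -/
def junction {N : ℕ} (e : Fin N → Plane) : Set Plane :=
  {x | ∃ i, ∃ r : ℝ, 0 ≤ r ∧ x = r • e i}

/-- The Hamiltonian `H = ℓ^*`: `H(p) = sup_{q ∈ ℝ} (p q - ℓ(q))`. -/
def ham (ℓ : ℝ → ℝ) (p : ℝ) : ℝ := ⨆ q : ℝ, (p * q - ℓ q)

/-- `H^-(p) = sup_{q ≤ 0} (p q - ℓ(q))`. -/
def hamMinus (ℓ : ℝ → ℝ) (p : ℝ) : ℝ := ⨆ q : Set.Iic (0 : ℝ), (p * (q : ℝ) - ℓ q)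

/-- `ℓ` is `C²` with `ℓ'' ≥ γ`. -/
def IsUniformlyConvexC2 (γ : ℝ) (ℓ : ℝ → ℝ) : Prop :=
  ContDiff ℝ 2 ℓ ∧ ∀ q, γ ≤ deriv (deriv ℓ) q

/-! ### Viscosity (sub-)solutions -/

/-- `v` is a (classical, continuous) viscosity solution of `v_t + H(v_r) = 0` on the open set
`U ⊆ ℝ × ℝ` of points `(t, r)`; test functions are `C¹` on `U` and touch `v` locally. -/
def IsViscositySolution (H : ℝ → ℝ) (U : Set (ℝ × ℝ)) (v : ℝ × ℝ → ℝ) : Prop :=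
  ContinuousOn v U ∧
  ∀ φ : ℝ × ℝ → ℝ, ContDiffOn ℝ 1 φ U → ∀ t r : ℝ, (t, r) ∈ U → v (t, r) = φ (t, r) →
    ((∀ᶠ z in 𝓝 (t, r), v z ≤ φ z) →
      deriv (fun s => φ (s, r)) t + H (deriv (fun ρ => φ (t, ρ)) r) ≤ 0) ∧
    ((∀ᶠ z in 𝓝 (t, r), φ z ≤ v z) →
      0 ≤ deriv (fun s => φ (s, r)) t + H (deriv (fun ρ => φ (t, ρ)) r))

/-- The restriction of a function of `(t, x)` to the branch `i`, in the coordinates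
`(t, r) ↦ (t, r e_i)`. -/
def onBranch {N : ℕ} (e : Fin N → Plane) (i : Fin N) (u : ℝ × Plane → ℝ) : ℝ × ℝ → ℝ :=
  fun z => u (z.1, z.2 • e i)

/-- The space `C¹_*(J_T)`: continuous on `J_T = (0,T) × J` and, on each closed branch,
`C¹` up to the junction point. -/
def IsC1Star {N : ℕ} (e : Fin N → Plane) (T : ℝ) (φ : ℝ × Plane → ℝ) : Prop :=
  ContinuousOn φ (Ioo 0 T ×ˢ junction e) ∧
  ∀ i, ContDiffOn ℝ 1 (onBranch e i φ) (Ioo 0 T ×ˢ Ici 0)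

/-- The time derivative `φ_t(t,x)`. -/
def timeDeriv (φ : ℝ × Plane → ℝ) (t : ℝ) (x : Plane) : ℝ := deriv (fun s => φ (s, x)) t

/-- The space derivative `φ^i_x(t, r e_i)` along branch `i` (one-sided for `r = 0`). -/
def branchDeriv {N : ℕ} (e : Fin N → Plane) (i : Fin N) (φ : ℝ × Plane → ℝ) (t r : ℝ) : ℝ :=
  derivWithin (fun ρ => onBranch e i φ (t, ρ)) (Ici 0) r

/-- `u : [0,T) × J → ℝ` is a viscosity sub-solution on `J_T` of
`u_t + H_i(u_x) = 0` on each open branch and `u_t + max_i H_i^-(u^i_x) = 0` at the junction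
point, with initial condition `u(0,·) ≤ u₀`. -/
def IsSubsolution {N : ℕ} (e : Fin N → Plane) (L : Fin N → ℝ → ℝ) (T : ℝ) (u₀ : Plane → ℝ)
    (u : ℝ × Plane → ℝ) : Prop :=
  UpperSemicontinuousOn u (Ico 0 T ×ˢ junction e) ∧
  (∀ φ : ℝ × Plane → ℝ, IsC1Star e T φ → ∀ t ∈ Ioo 0 T, ∀ x ∈ junction e,
    u (t, x) = φ (t, x) →
    (∀ᶠ z in 𝓝[Ioo 0 T ×ˢ junction e] (t, x), u z ≤ φ z) →
    (∀ i, ∀ r : ℝ, 0 < r → x = r • e i →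
      timeDeriv φ t x + ham (L i) (branchDeriv e i φ t r) ≤ 0) ∧
    (x = 0 → timeDeriv φ t 0 + (⨆ i, hamMinus (L i) (branchDeriv e i φ t 0)) ≤ 0)) ∧
  ∀ x ∈ junction e, u (0, x) ≤ u₀ x

/-- `u` is continuous on `[0,T) × J`, `u(0,·) = u₀`, and each `u^i` is a viscosity solution of
`u_t + H_i(u_x) = 0` on the open branch `(0,T) × J_i^*`; nothing is imposed at the junction. -/
def IsBranchwiseSolution {N : ℕ} (e : Fin N → Plane) (L : Fin N → ℝ → ℝ) (T : ℝ)
    (u₀ : Plane → ℝ) (u : ℝ × Plane → ℝ) : Prop :=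
  ContinuousOn u (Ico 0 T ×ˢ junction e) ∧
  (∀ x ∈ junction e, u (0, x) = u₀ x) ∧
  ∀ i, IsViscositySolution (ham (L i)) (Ioo 0 T ×ˢ Ioi 0) (onBranch e i u)

/-! ### The optimal control problem -/

/-- The set `A(x)` of admissible controls: `ℝ e_i` if `x ∈ J_i^*`, and `⋃_i ℝ⁺ e_i` at `0`. -/
def controls {N : ℕ} (e : Fin N → Plane) (x : Plane) : Set Plane :=
  {P | (x = 0 ∧ ∃ i, ∃ p : ℝ, 0 ≤ p ∧ P = p • e i) ∨
       (∃ i, x ∈ openBranch e i ∧ ∃ p : ℝ, P = p • e i)}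

/-- `X ∈ W^{1,1}([s,t]; ℝ²)` (continuous representative) with weak derivative `V`:
`V` is integrable and `X` is a primitive of it. -/
def IsW11 (s t : ℝ) (X V : ℝ → Plane) : Prop :=
  IntervalIntegrable V volume s t ∧ ∀ τ ∈ Icc s t, X τ = X s + ∫ σ in s..τ, V σ

/-- `X`, with derivative `V`, is an admissible trajectory from `(s,y)` to `(t,x)`. -/
def IsAdmissible {N : ℕ} (e : Fin N → Plane) (s : ℝ) (y : Plane) (t : ℝ) (x : Plane)
    (X V : ℝ → Plane) : Prop :=
  IsW11 s t X V ∧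
  (∀ τ ∈ Ioo s t, X τ ∈ junction e) ∧
  (∀ᵐ τ ∂(volume.restrict (Ioo s t)), V τ ∈ controls e (X τ)) ∧
  X s = y ∧ X t = x

open Classical in
/-- The Lagrangian `L(x,P)` on the junction, for `P = p e_i ∈ A(x)`: it is `L_i(p)` if
`x ∈ J_i^*` (then `p = ⟨e_i, P⟩`), and `min_j L_j(p)` if `x = 0` (then `p = |P|`).
The sum over `i` has exactly one active term if `x ∈ J \ {0}`. -/
def lagrangian {N : ℕ} (e : Fin N → Plane) (L : Fin N → ℝ → ℝ) (x P : Plane) : ℝ :=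
  if x = 0 then ⨅ j, L j ‖P‖
  else ∑ i, if x ∈ openBranch e i then L i (inner ℝ (e i) P) else 0

/-- All values `u₀(y) + ∫_0^t L(X, Ẋ) dτ` over `y ∈ J` and admissible trajectories from `(0,y)`
to `(t,x)`. The Lagrangian is bounded below along trajectories, so those with a non-integrable
running cost have cost `+∞` and do not affect the infimum; they are left out. -/
def costs {N : ℕ} (e : Fin N → Plane) (L : Fin N → ℝ → ℝ) (u₀ : Plane → ℝ)
    (t : ℝ) (x : Plane) : Set ℝ :=
  {c | ∃ y ∈ junction e, ∃ X V : ℝ → Plane, IsAdmissible e 0 y t x X V ∧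
    IntervalIntegrable (fun τ => lagrangian e L (X τ) (V τ)) volume 0 t ∧
    c = u₀ y + ∫ τ in (0 : ℝ)..t, lagrangian e L (X τ) (V τ)}

/-- The optimal control solution (value function) `u_oc(t,x)`. -/
def uoc {N : ℕ} (e : Fin N → Plane) (L : Fin N → ℝ → ℝ) (u₀ : Plane → ℝ) : ℝ × Plane → ℝ :=
  fun z => sInf (costs e L u₀ z.1 z.2)

end

end JunctionHJ

/-! Everything rests on one inequality: along a straight line of slope `q` in a closed branch `i`,
from `(s, a)` to `(t, b)`, one has `u(t, b e_i) ≤ u(s, a e_i) + (t - s) L_i(q)`. For a branchwise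
solution it is proved in the open branch, by touching `u` from above with a test function penalized
around the line (`IsViscositySolution.le_segment`). Continuity alone carries it to lines that touch
the junction point (`le_segment_of_continuousOn`), and this is why no junction condition has to be
assumed.

The sub-solution property follows by differentiating a test function backwards along such lines.
Away from the junction every `q` is allowed and the supremum is `H_i`. At the junction point the
line must come from inside the branch, so `q ≤ 0`, and the supremum is `H_i^-` (`test_add_mul_le`).

For `u ≤ u_oc`, a trajectory is cut at its first and last visits to the junction point
(`IsRun.le_add_cost`). The two outer pieces lie in a single branch, where Jensen's inequality
compares them with straight lines. The middle piece may make infinitely many excursions, but it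
costs at least as much as standing still (`IsRun.stay_le_cost`): in `L_i(p) ≥ L_i(0) + L_i'(0) p`
the linear terms integrate to zero, because every branch coordinate vanishes at both ends.

For `u_oc` itself, finiteness comes from superlinearity of the `L_i`, which beats the Lipschitz
growth of `u₀`. Lipschitz regularity comes from concatenating and time-shifting trajectories. The
segment inequality holds because segments are admissible, and gives the viscosity sub-solution
property. The super-solution property compares each trajectory, after its last entry into a small
ball, with a strict classical sub-solution. -/

namespace JunctionHJ

/-! ### Uniformly convex Lagrangians and their conjugates. -/

section Convexity

variable {γ : ℝ} {ℓ : ℝ → ℝ}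

theorem IsUniformlyConvexC2.differentiable (h : IsUniformlyConvexC2 γ ℓ) : Differentiable ℝ ℓ :=
  h.1.differentiable (by norm_num)

theorem IsUniformlyConvexC2.differentiable_deriv (h : IsUniformlyConvexC2 γ ℓ) :
    Differentiable ℝ (deriv ℓ) := by
  have h2 : ContDiff ℝ (1 + 1) ℓ := by
    have := h.1
    norm_num
    exact this
  exact ((contDiff_succ_iff_deriv.1 h2).2.2).differentiable (by norm_num)

/-- Its second derivative is `ℓ'' - γ ≥ 0`. Tangent lines to this function give the quadratic lower
bound for `ℓ`. -/
theorem IsUniformlyConvexC2.convexOn_sub_sq (h : IsUniformlyConvexC2 γ ℓ) :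
    ConvexOn ℝ univ (fun p => ℓ p - γ / 2 * p ^ 2) := by
  have hd1 : ∀ p, HasDerivAt (fun p => ℓ p - γ / 2 * p ^ 2) (deriv ℓ p - γ * p) p := by
    intro p
    have := (h.differentiable p).hasDerivAt.sub (((hasDerivAt_id p).pow 2).const_mul (γ / 2))
    convert! this using 1
    simp
    ring
  have hd2 : ∀ p, HasDerivAt (fun p => deriv ℓ p - γ * p) (deriv (deriv ℓ) p - γ) p := by
    intro p
    have := (h.differentiable_deriv p).hasDerivAt.sub ((hasDerivAt_id p).const_mul γ)
    convert! this using 1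
    simp
  have e1 : deriv (fun p => ℓ p - γ / 2 * p ^ 2) = fun p => deriv ℓ p - γ * p :=
    funext fun p => (hd1 p).deriv
  refine convexOn_univ_of_deriv2_nonneg (fun p => (hd1 p).differentiableAt) ?_ ?_
  · rw [e1]
    exact fun p => (hd2 p).differentiableAt
  · intro p
    simp only [Function.iterate_succ, Function.iterate_zero, Function.comp_apply, id]
    rw [e1, (hd2 p).deriv]
    linarith [h.2 p]

/-- The quadratic lower bound at `q`. -/
theorem IsUniformlyConvexC2.quadratic_le (h : IsUniformlyConvexC2 γ ℓ) (q p : ℝ) :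
    ℓ q + deriv ℓ q * (p - q) + γ / 2 * (p - q) ^ 2 ≤ ℓ p := by
  have hd : HasDerivAt (fun p => ℓ p - γ / 2 * p ^ 2) (deriv ℓ q - γ * q) q := by
    have := (h.differentiable q).hasDerivAt.sub (((hasDerivAt_id q).pow 2).const_mul (γ / 2))
    convert! this using 1
    simp
    ring
  have hc := h.convexOn_sub_sq
  rcases lt_trichotomy q p with hqp | rfl | hpq
  · have := hc.le_slope_of_hasDerivAt (mem_univ q) (mem_univ p) hqp hd
    rw [slope_def_field, le_div_iff₀ (by linarith)] at this
    linarith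
  · simp
  · have := hc.slope_le_of_hasDerivAt (mem_univ p) (mem_univ q) hpq hd
    rw [slope_def_field, div_le_iff₀ (by linarith)] at this
    linarith

theorem IsUniformlyConvexC2.tangent_le (h : IsUniformlyConvexC2 γ ℓ) (hγ : 0 < γ) (q p : ℝ) :
    ℓ q + deriv ℓ q * (p - q) ≤ ℓ p := by
  have := h.quadratic_le q p
  nlinarith [sq_nonneg (p - q)]

theorem IsUniformlyConvexC2.superlinear (h : IsUniformlyConvexC2 γ ℓ) (hγ : 0 < γ) (K : ℝ) :
    ∃ C, ∀ p, K * |p| - C ≤ ℓ p := by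
  -- The quadratic bound at `0` dominates the linear terms by completing a square; this constant is
  -- what the square leaves over.
  refine ⟨(|K| + |deriv ℓ 0|) ^ 2 / (2 * γ) - ℓ 0, fun p => ?_⟩
  have h1 := h.quadratic_le 0 p
  have h2 : -(|deriv ℓ 0| * |p|) ≤ deriv ℓ 0 * p := by
    rw [← abs_mul]
    exact neg_abs_le _
  have h3 : K * |p| ≤ |K| * |p| := mul_le_mul_of_nonneg_right (le_abs_self K) (abs_nonneg p)
  have h4 : (|K| + |deriv ℓ 0|) * |p| ≤ γ / 2 * |p| ^ 2 + (|K| + |deriv ℓ 0|) ^ 2 / (2 * γ) := by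
    have : 0 ≤ γ / 2 * (|p| - (|K| + |deriv ℓ 0|) / γ) ^ 2 := by positivity
    have e : γ / 2 * (|p| - (|K| + |deriv ℓ 0|) / γ) ^ 2
      = γ / 2 * |p| ^ 2 + (|K| + |deriv ℓ 0|) ^ 2 / (2 * γ) - (|K| + |deriv ℓ 0|) * |p| := by
      field_simp
      ring
    linarith
  rw [sq_abs] at h4
  simp only [sub_zero] at h1
  linarith

/-- Superlinearity makes `ham` a genuine supremum; an unbounded real `⨆` would take a default value,
and Fenchel's inequality would be lost. -/
theorem IsUniformlyConvexC2.bddAbove (h : IsUniformlyConvexC2 γ ℓ) (hγ : 0 < γ) (p : ℝ) :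
    BddAbove (range fun q => p * q - ℓ q) := by
  obtain ⟨C, hC⟩ := h.superlinear hγ |p|
  refine ⟨C, ?_⟩
  rintro _ ⟨q, rfl⟩
  have : p * q ≤ |p| * |q| := by
    rw [← abs_mul]
    exact le_abs_self _
  simp only
  linarith [hC q]

theorem IsUniformlyConvexC2.le_ham (h : IsUniformlyConvexC2 γ ℓ) (hγ : 0 < γ) (p q : ℝ) :
    p * q - ℓ q ≤ ham ℓ p :=
  le_ciSup (h.bddAbove hγ p) q

/-- A finite supremum of affine functions is convex on the line, hence continuous. -/
theorem IsUniformlyConvexC2.continuous_ham (h : IsUniformlyConvexC2 γ ℓ) (hγ : 0 < γ) :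
    Continuous (ham ℓ) := by
  have hc : ConvexOn ℝ univ (ham ℓ) := by
    refine ⟨convex_univ, fun x _ y _ a b ha hb hab => ciSup_le fun q => ?_⟩
    have h1 := mul_le_mul_of_nonneg_left (h.le_ham hγ x q) ha
    have h2 := mul_le_mul_of_nonneg_left (h.le_ham hγ y q) hb
    simp only [smul_eq_mul]
    have : ℓ q = a * ℓ q + b * ℓ q := by rw [← add_mul, hab, one_mul]
    linarith
  exact continuousOn_univ.1 (hc.continuousOn isOpen_univ)

end Convexity

/-! ### Branch coordinates on the junction. -/

section Geometry

variable {N : ℕ} {e : Fin N → Plane}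

/-- A number in `[0,1)` bounding the cosines of the angles between the branch `i` and the
others. -/
noncomputable def maxCos (e : Fin N → Plane) (i : Fin N) : ℝ :=
  ⨆ j, if j = i then 0 else max 0 (inner ℝ (e i) (e j))

/-- A Lipschitz function on the plane which is equal to `r` at `r e_i`, and vanishes on the
other branches. -/
noncomputable def coord (e : Fin N → Plane) (i : Fin N) (x : Plane) : ℝ :=
  max 0 ((inner ℝ (e i) x - maxCos e i * ‖x‖) / (1 - maxCos e i))

theorem inner_le_maxCos (e : Fin N → Plane) {i j : Fin N} (hij : j ≠ i) :
    inner ℝ (e i) (e j) ≤ maxCos e i := by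
  have := le_ciSup (f := fun j => if j = i then (0 : ℝ) else max 0 (inner ℝ (e i) (e j)))
    (Set.finite_range _).bddAbove j
  simp only [hij, if_false] at this
  exact (le_max_right _ _).trans this

theorem maxCos_lt_one (he : ∀ i, ‖e i‖ = 1) (hinj : Function.Injective e) (i : Fin N) :
    maxCos e i < 1 := by
  have : Nonempty (Fin N) := ⟨i⟩
  obtain ⟨j, hj⟩ := exists_eq_ciSup_of_finite
    (f := fun j => if j = i then (0 : ℝ) else max 0 (inner ℝ (e i) (e j)))
  rw [maxCos, ← hj]
  by_cases h : j = i
  · simp [h]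
  · simp only [h, if_false]
    refine max_lt one_pos ((inner_lt_one_iff_real_of_norm_eq_one (he i) (he j)).2 ?_)
    exact fun hh => h (hinj hh).symm

theorem coord_nonneg (e : Fin N → Plane) (i : Fin N) (x : Plane) : 0 ≤ coord e i x :=
  le_max_left _ _

theorem coord_smul_self (he : ∀ i, ‖e i‖ = 1) (hinj : Function.Injective e) (i : Fin N) {r : ℝ}
    (hr : 0 ≤ r) : coord e i (r • e i) = r := by
  have h1 := maxCos_lt_one he hinj i
  have h2 : (1 - maxCos e i) ≠ 0 := by linarith
  rw [coord, inner_smul_right, real_inner_self_eq_norm_sq, norm_smul, he i, Real.norm_eq_abs,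
    abs_of_nonneg hr]
  have : (r * 1 ^ 2 - maxCos e i * (r * 1)) / (1 - maxCos e i) = r := by
    field_simp
  rw [this, max_eq_right hr]

theorem coord_smul_of_ne (he : ∀ i, ‖e i‖ = 1) (hinj : Function.Injective e) {i j : Fin N}
    (hij : j ≠ i) {r : ℝ} (hr : 0 ≤ r) : coord e i (r • e j) = 0 := by
  have h1 := maxCos_lt_one he hinj i
  rw [coord, inner_smul_right, norm_smul, he j, Real.norm_eq_abs, abs_of_nonneg hr]
  refine max_eq_left (div_nonpos_of_nonpos_of_nonneg ?_ (by linarith))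
  nlinarith [inner_le_maxCos e hij]

theorem coord_zero (e : Fin N → Plane) (i : Fin N) : coord e i 0 = 0 := by
  simp [coord]

/-- The Lipschitz bound is what makes the branch coordinates of a trajectory absolutely continuous.
-/
theorem exists_lipschitzWith_coord (e : Fin N → Plane) (i : Fin N) :
    ∃ C, LipschitzWith C (coord e i) := by
  have h1 : LipschitzWith _ (fun x : Plane => inner ℝ (e i) x) := (innerSL ℝ (e i)).lipschitz
  have h2 : LipschitzWith _ (fun x : Plane => maxCos e i * ‖x‖) :=
    lipschitzWith_smul (maxCos e i) |>.comp lipschitzWith_one_norm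
  have h3 := (lipschitzWith_smul ((1 - maxCos e i)⁻¹)).comp (h1.sub h2)
  have h4 : coord e i = fun x => max 0 ((1 - maxCos e i)⁻¹ • (inner ℝ (e i) x - maxCos e i * ‖x‖)) :=
    funext fun x => by rw [coord, smul_eq_mul, div_eq_inv_mul]
  rw [h4]
  exact ⟨_, h3.const_max 0⟩

theorem continuous_coord (e : Fin N → Plane) (i : Fin N) : Continuous (coord e i) :=
  (exists_lipschitzWith_coord e i).choose_spec.continuous

theorem zero_mem_junction (i : Fin N) : (0 : Plane) ∈ junction e := ⟨i, 0, le_rfl, by simp⟩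

theorem smul_mem_junction (i : Fin N) {r : ℝ} (hr : 0 ≤ r) : r • e i ∈ junction e :=
  ⟨i, r, hr, rfl⟩

theorem eq_coord_smul (he : ∀ i, ‖e i‖ = 1) (hinj : Function.Injective e) {i : Fin N} {x : Plane}
    (hx : x ∈ junction e) (h : 0 < coord e i x) : x = coord e i x • e i := by
  obtain ⟨j, r, hr, rfl⟩ := hx
  by_cases hij : j = i
  · subst hij
    rw [coord_smul_self he hinj j hr]
  · rw [coord_smul_of_ne he hinj hij hr] at h
    exact absurd h (lt_irrefl _)

theorem exists_coord_pos (he : ∀ i, ‖e i‖ = 1) (hinj : Function.Injective e) {x : Plane}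
    (hx : x ∈ junction e) (h0 : x ≠ 0) : ∃ i, 0 < coord e i x := by
  obtain ⟨j, r, hr, rfl⟩ := hx
  refine ⟨j, ?_⟩
  rw [coord_smul_self he hinj j hr]
  refine lt_of_le_of_ne hr ?_
  rintro rfl
  simp at h0

theorem coord_eq_zero_of_ne (he : ∀ i, ‖e i‖ = 1) (hinj : Function.Injective e) {i j : Fin N}
    {x : Plane} (hx : x ∈ junction e) (hij : j ≠ i) (h : 0 < coord e i x) : coord e j x = 0 := by
  rw [eq_coord_smul he hinj hx h]
  exact coord_smul_of_ne he hinj hij.symm h.le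

theorem mem_openBranch_iff (he : ∀ i, ‖e i‖ = 1) (hinj : Function.Injective e) {i : Fin N}
    {x : Plane} (hx : x ∈ junction e) : x ∈ openBranch e i ↔ 0 < coord e i x := by
  constructor
  · rintro ⟨r, hr, rfl⟩
    rwa [coord_smul_self he hinj i hr.le]
  · exact fun h => ⟨_, h, eq_coord_smul he hinj hx h⟩

theorem control_eq_smul (he : ∀ i, ‖e i‖ = 1) (hinj : Function.Injective e) {i : Fin N}
    {x V : Plane} (hx : x ∈ junction e) (h : 0 < coord e i x) (hV : V ∈ controls e x) :
    V = (inner ℝ (e i) V : ℝ) • e i := by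
  rcases hV with ⟨rfl, -⟩ | ⟨j, hj, p, rfl⟩
  · simp [coord_zero] at h
  · have hji : j = i := by
      by_contra hne
      have := coord_eq_zero_of_ne he hinj hx hne h
      rw [mem_openBranch_iff he hinj hx, this] at hj
      exact lt_irrefl _ hj
    subst hji
    rw [inner_smul_right, real_inner_self_eq_norm_sq, he j]
    simp

theorem lagrangian_of_coord_pos (he : ∀ i, ‖e i‖ = 1) (hinj : Function.Injective e)
    (L : Fin N → ℝ → ℝ) {i : Fin N} {x : Plane} (hx : x ∈ junction e) (h : 0 < coord e i x)
    (V : Plane) : lagrangian e L x V = L i (inner ℝ (e i) V) := by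
  have hx0 : x ≠ 0 := by
    rintro rfl
    simp [coord_zero] at h
  rw [lagrangian, if_neg hx0, Finset.sum_eq_single i]
  · rw [if_pos ((mem_openBranch_iff he hinj hx).2 h)]
  · intro j _ hji
    rw [if_neg]
    rw [mem_openBranch_iff he hinj hx, coord_eq_zero_of_ne he hinj hx hji h]
    exact lt_irrefl _
  · simp

theorem lagrangian_zero (L : Fin N → ℝ → ℝ) (V : Plane) :
    lagrangian e L 0 V = ⨅ j, L j ‖V‖ := by
  rw [lagrangian, if_pos rfl]

theorem le_lagrangian (he : ∀ i, ‖e i‖ = 1) (hinj : Function.Injective e) (hN : 1 ≤ N)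
    {L : Fin N → ℝ → ℝ} {K C : ℝ} (hL : ∀ i p, K * |p| - C ≤ L i p) {x V : Plane}
    (hx : x ∈ junction e) (hV : V ∈ controls e x) : K * ‖V‖ - C ≤ lagrangian e L x V := by
  have : Nonempty (Fin N) := ⟨⟨0, hN⟩⟩
  by_cases h0 : x = 0
  · subst h0
    rw [lagrangian_zero]
    refine le_ciInf fun j => ?_
    simpa using hL j ‖V‖
  · obtain ⟨i, hi⟩ := exists_coord_pos he hinj hx h0
    rw [lagrangian_of_coord_pos he hinj L hx hi]
    have : ‖V‖ = |inner ℝ (e i) V| := by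
      conv_lhs => rw [control_eq_smul he hinj hx hi hV]
      rw [norm_smul, he i, mul_one, Real.norm_eq_abs]
    rw [this]
    exact hL i _

end Geometry

/-! ### Admissible trajectories: restriction, shift, concatenation, segments. -/

section Trajectories

variable {N : ℕ} {e : Fin N → Plane} {L : Fin N → ℝ → ℝ}

/-- `X`, with derivative `V`, is an admissible trajectory in the junction on `[s,t]`, whose running
cost is integrable. -/
structure IsRun (e : Fin N → Plane) (L : Fin N → ℝ → ℝ) (s t : ℝ) (X V : ℝ → Plane) : Prop where
  integrable : IntervalIntegrable V volume s t
  primitive : ∀ τ ∈ Icc s t, X τ = X s + ∫ σ in s..τ, V σ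
  mem : ∀ τ ∈ Icc s t, X τ ∈ junction e
  control : ∀ᵐ τ, τ ∈ Ioo s t → V τ ∈ controls e (X τ)
  cost : IntervalIntegrable (fun τ => lagrangian e L (X τ) (V τ)) volume s t

/-- Admissibility constrains the trajectory to `J` only at interior times; the conditions on the two
end points extend this to the closed interval. -/
theorem mem_costs_iff {u₀ : Plane → ℝ} {t : ℝ} {x : Plane} (ht : 0 ≤ t) (hx : x ∈ junction e)
    {c : ℝ} : c ∈ costs e L u₀ t x ↔ ∃ X V, IsRun e L 0 t X V ∧ X t = x ∧
      c = u₀ (X 0) + ∫ τ in (0 : ℝ)..t, lagrangian e L (X τ) (V τ) := by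
  constructor
  · rintro ⟨y, hy, X, V, ⟨hW, hJ, hc, h0, hX⟩, hi, rfl⟩
    refine ⟨X, V, ⟨hW.1, hW.2, ?_, ?_, hi⟩, hX, by rw [h0]⟩
    · rintro τ ⟨h1, h2⟩
      rcases h1.eq_or_lt with rfl | h1
      · rwa [h0]
      rcases h2.eq_or_lt with rfl | h2
      · rwa [hX]
      exact hJ τ ⟨h1, h2⟩
    · exact (ae_restrict_iff' measurableSet_Ioo).1 hc
  · rintro ⟨X, V, h, hX, rfl⟩
    exact ⟨X 0, h.mem 0 ⟨le_rfl, ht⟩, X, V, ⟨⟨h.integrable, h.primitive⟩,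
      fun τ hτ => h.mem τ (Ioo_subset_Icc_self hτ),
      (ae_restrict_iff' measurableSet_Ioo).2 h.control, rfl, hX⟩, h.cost, rfl⟩

variable {s t : ℝ} {X V : ℝ → Plane}

theorem IsRun.sub_eq_integral (h : IsRun e L s t X V) {a b : ℝ} (ha : a ∈ Icc s t)
    (hb : b ∈ Icc s t) : X b - X a = ∫ σ in a..b, V σ := by
  have hst : s ≤ t := ha.1.trans ha.2
  rw [h.primitive a ha, h.primitive b hb, add_sub_add_left_eq_sub]
  have hi : ∀ c ∈ Icc s t, IntervalIntegrable V volume s c := fun c hc =>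
    h.integrable.mono_set (by
      rw [uIcc_of_le hc.1, uIcc_of_le hst]
      exact Icc_subset_Icc_right hc.2)
  exact intervalIntegral.integral_interval_sub_left (hi b hb) (hi a ha)

theorem IsRun.restrict (h : IsRun e L s t X V) {a b : ℝ} (ha : s ≤ a) (hab : a ≤ b) (hb : b ≤ t) :
    IsRun e L a b X V := by
  have hsub : uIcc a b ⊆ uIcc s t := by
    rw [uIcc_of_le hab, uIcc_of_le (ha.trans (hab.trans hb))]
    exact Icc_subset_Icc ha hb
  refine ⟨h.integrable.mono_set hsub, fun τ hτ => ?_,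
    fun τ hτ => h.mem τ (Icc_subset_Icc ha hb hτ), ?_, h.cost.mono_set hsub⟩
  · rw [← h.sub_eq_integral ⟨ha, hab.trans hb⟩ (Icc_subset_Icc ha hb hτ)]
    abel
  · filter_upwards [h.control] with τ hτ hm
    exact hτ (Ioo_subset_Ioo ha hb hm)

theorem IsRun.continuousOn (h : IsRun e L s t X V) (hst : s ≤ t) : ContinuousOn X (Icc s t) := by
  have := intervalIntegral.continuousOn_primitive_interval' h.integrable left_mem_uIcc
  rw [uIcc_of_le hst] at this
  exact (continuousOn_const.add this).congr h.primitive

theorem IsRun.comp_add_right (h : IsRun e L s t X V) (a : ℝ) :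
    IsRun e L (s - a) (t - a) (fun τ => X (τ + a)) (fun τ => V (τ + a)) := by
  refine ⟨h.integrable.comp_add_right a, fun τ hτ => ?_, fun τ hτ => ?_, ?_,
    h.cost.comp_add_right a⟩
  · have hm : τ + a ∈ Icc s t := ⟨by linarith [hτ.1], by linarith [hτ.2]⟩
    simp only [sub_add_cancel]
    rw [intervalIntegral.integral_comp_add_right, sub_add_cancel]
    exact h.primitive _ hm
  · exact h.mem _ ⟨by linarith [hτ.1], by linarith [hτ.2]⟩
  · have := (measurePreserving_add_right volume a).quasiMeasurePreserving.ae h.control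
    filter_upwards [this] with τ hτ hm
    exact hτ ⟨by linarith [hm.1], by linarith [hm.2]⟩

/-- The positions agree at `m`, and the velocity chosen at that single time does not affect the
integrals. -/
theorem IsRun.concat {m : ℝ} {X' V' : ℝ → Plane} (hsm : s ≤ m) (hmt : m ≤ t)
    (h : IsRun e L s m X V) (h' : IsRun e L m t X' V') (hm : X m = X' m) :
    ∃ Y W, IsRun e L s t Y W ∧ Y s = X s ∧ Y t = X' t ∧
      ∫ τ in s..t, lagrangian e L (Y τ) (W τ) =
        (∫ τ in s..m, lagrangian e L (X τ) (V τ)) + ∫ τ in m..t, lagrangian e L (X' τ) (V' τ) := by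
  classical
  set Y : ℝ → Plane := fun τ => if τ ≤ m then X τ else X' τ with hY
  set W : ℝ → Plane := fun τ => if τ ≤ m then V τ else V' τ with hW
  have hY1 : ∀ τ, τ ≤ m → Y τ = X τ := fun τ h => if_pos h
  have hW1 : ∀ τ, τ ≤ m → W τ = V τ := fun τ h => if_pos h
  have hY2 : ∀ τ, m ≤ τ → Y τ = X' τ := by
    intro τ hτ
    rcases hτ.eq_or_lt with rfl | hlt
    · rw [hY1 _ le_rfl, hm]
    · exact if_neg hlt.not_ge
  have hW2 : ∀ τ, m < τ → W τ = V' τ := fun τ h => if_neg h.not_ge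
  have i1 : IntervalIntegrable W volume s m := h.integrable.congr fun τ hτ => by
    rw [uIoc_of_le hsm] at hτ
    exact (hW1 τ hτ.2).symm
  have i2 : IntervalIntegrable W volume m t := h'.integrable.congr fun τ hτ => by
    rw [uIoc_of_le hmt] at hτ
    exact (hW2 τ hτ.1).symm
  have e1 : ∀ τ ∈ Ioc s m, lagrangian e L (X τ) (V τ) = lagrangian e L (Y τ) (W τ) :=
    fun τ hτ => by rw [hY1 τ hτ.2, hW1 τ hτ.2]
  have e2 : ∀ τ ∈ Ioc m t, lagrangian e L (X' τ) (V' τ) = lagrangian e L (Y τ) (W τ) :=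
    fun τ hτ => by rw [hY2 τ hτ.1.le, hW2 τ hτ.1]
  have c1 : IntervalIntegrable (fun τ => lagrangian e L (Y τ) (W τ)) volume s m :=
    h.cost.congr (by rwa [uIoc_of_le hsm])
  have c2 : IntervalIntegrable (fun τ => lagrangian e L (Y τ) (W τ)) volume m t :=
    h'.cost.congr (by rwa [uIoc_of_le hmt])
  have p1 : ∀ τ ∈ Icc s m, ∫ σ in s..τ, W σ = ∫ σ in s..τ, V σ := fun τ hτ =>
    intervalIntegral.integral_congr fun σ hσ => by
      rw [uIcc_of_le hτ.1] at hσ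
      exact hW1 σ (hσ.2.trans hτ.2)
  have p2 : ∀ τ ∈ Icc m t, ∫ σ in m..τ, W σ = ∫ σ in m..τ, V' σ := fun τ hτ =>
    intervalIntegral.integral_congr_Ioo_of_le hτ.1 fun σ hσ => hW2 σ hσ.1
  refine ⟨Y, W, ⟨i1.trans i2, fun τ hτ => ?_, fun τ hτ => ?_, ?_, c1.trans c2⟩, hY1 s hsm,
    hY2 t hmt, ?_⟩
  · rcases le_total τ m with hle | hle
    · rw [hY1 τ hle, hY1 s hsm, p1 τ ⟨hτ.1, hle⟩]
      exact h.primitive τ ⟨hτ.1, hle⟩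
    · have i3 : IntervalIntegrable W volume m τ := i2.mono_set (by
        rw [uIcc_of_le hle, uIcc_of_le hmt]
        exact Icc_subset_Icc_right hτ.2)
      rw [hY2 τ hle, hY1 s hsm, ← intervalIntegral.integral_add_adjacent_intervals i1 i3,
        p1 m ⟨hsm, le_rfl⟩, p2 τ ⟨hle, hτ.2⟩, ← add_assoc, ← h.primitive m ⟨hsm, le_rfl⟩, hm]
      exact h'.primitive τ ⟨hle, hτ.2⟩
  · rcases le_total τ m with hle | hle
    · rw [hY1 τ hle]
      exact h.mem τ ⟨hτ.1, hle⟩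
    · rw [hY2 τ hle]
      exact h'.mem τ ⟨hle, hτ.2⟩
  · have hne : ∀ᵐ τ : ℝ, τ ≠ m := by simp [ae_iff, measure_singleton]
    filter_upwards [h.control, h'.control, hne] with τ h1 h2 h3 hτ
    rcases lt_or_gt_of_ne h3 with hlt | hlt
    · rw [hY1 τ hlt.le, hW1 τ hlt.le]
      exact h1 ⟨hτ.1, hlt⟩
    · rw [hY2 τ hlt.le, hW2 τ hlt]
      exact h2 ⟨hlt, hτ.2⟩
  · rw [← intervalIntegral.integral_add_adjacent_intervals c1 c2]
    congr 1
    · exact intervalIntegral.integral_congr_Ioo_of_le hsm fun τ hτ => (e1 τ ⟨hτ.1, hτ.2.le⟩).symm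
    · exact intervalIntegral.integral_congr_Ioo_of_le hmt fun τ hτ => (e2 τ ⟨hτ.1, hτ.2.le⟩).symm

theorem intervalIntegrable_of_eqOn_const {f : ℝ → ℝ} {c : ℝ} (hst : s ≤ t)
    (h : EqOn f (fun _ => c) (Ioo s t)) : IntervalIntegrable f volume s t ∧
      ∫ τ in s..t, f τ = (t - s) * c := by
  constructor
  · exact (intervalIntegrable_const (c := c)).congr_uIoo (by rw [uIoo_of_le hst]; exact h.symm)
  · rw [intervalIntegral.integral_congr_Ioo_of_le hst h, intervalIntegral.integral_const,
      smul_eq_mul]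

/-- The straight line trajectories along a branch. -/
theorem exists_isRun_segment (he : ∀ i, ‖e i‖ = 1) (hinj : Function.Injective e) (i : Fin N)
    {a b q : ℝ} (hst : s ≤ t) (ha : 0 ≤ a) (hb : 0 ≤ b) (hq : b = a + q * (t - s)) :
    ∃ X V, IsRun e L s t X V ∧ X s = a • e i ∧ X t = b • e i ∧
      ∫ τ in s..t, lagrangian e L (X τ) (V τ) ≤ (t - s) * L i q := by
  set X : ℝ → Plane := fun τ => (a + q * (τ - s)) • e i with hX
  have hpos : ∀ τ ∈ Icc s t, 0 ≤ a + q * (τ - s) := by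
    intro τ hτ
    rcases le_total 0 q with hq0 | hq0
    · exact add_nonneg ha (mul_nonneg hq0 (by linarith [hτ.1]))
    · nlinarith [hτ.2]
  have hJ : ∀ τ ∈ Icc s t, X τ ∈ junction e := fun τ hτ => smul_mem_junction i (hpos τ hτ)
  have hXs : X s = a • e i := by simp [hX]
  have hXt : X t = b • e i := by simp [hX, hq]
  have hprim : ∀ τ ∈ Icc s t, X τ = X s + ∫ σ in s..τ, q • e i := by
    intro τ _
    rw [intervalIntegral.integral_const, hXs, smul_smul, ← add_smul, mul_comm]
  -- If both ends are the junction point, the trajectory rests there at cost rate `⨅ j, L j 0`,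
  -- which may be below `L i 0`; hence only `≤` in the conclusion. For `s = t` the slope `q` is
  -- arbitrary but nothing is integrated.
  by_cases h0 : a = 0 ∧ b = 0
  · obtain ⟨rfl, rfl⟩ := h0
    have hq0 : ∀ τ ∈ Icc s t, q * (τ - s) = 0 := by
      intro τ hτ
      rcases hst.eq_or_lt with rfl | hlt
      · have : τ = s := le_antisymm hτ.2 hτ.1
        simp [this]
      · have : q = 0 := by
          have := hq
          rw [zero_add] at this
          rcases mul_eq_zero.1 this.symm with h | h
          · exact h
          · linarith
        simp [this]
    have hX0 : ∀ τ ∈ Icc s t, X τ = 0 := fun τ hτ => by simp [hX, hq0 τ hτ]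
    rcases hst.eq_or_lt with rfl | hlt
    · refine ⟨X, fun _ => q • e i, ⟨by simp, hprim, hJ, by simp, by simp⟩, hXs, hXt, by simp⟩
    · have hq1 : q = 0 := by
        have := hq0 t ⟨hst, le_rfl⟩
        rcases mul_eq_zero.1 this with h | h
        · exact h
        · linarith
      subst hq1
      have hl : EqOn (fun τ => lagrangian e L (X τ) ((0 : ℝ) • e i)) (fun _ => ⨅ j, L j 0)
          (Ioo s t) := by
        intro τ hτ
        simp only
        rw [hX0 τ (Ioo_subset_Icc_self hτ), lagrangian_zero]
        simp
      obtain ⟨hi, hv⟩ := intervalIntegrable_of_eqOn_const hst hl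
      refine ⟨X, fun _ => (0 : ℝ) • e i, ⟨intervalIntegrable_const, hprim, hJ, ?_, hi⟩, hXs, hXt, ?_⟩
      · refine Eventually.of_forall fun τ hτ => Or.inl ⟨hX0 τ (Ioo_subset_Icc_self hτ), i, 0, le_rfl, rfl⟩
      · rw [hv]
        exact mul_le_mul_of_nonneg_left (ciInf_le (Set.finite_range _).bddBelow i) (by linarith)
  · have hpos' : ∀ τ ∈ Ioo s t, 0 < a + q * (τ - s) := by
      intro τ hτ
      by_contra hneg
      have hz : a + q * (τ - s) = 0 := le_antisymm (not_lt.1 hneg) (hpos τ (Ioo_subset_Icc_self hτ))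
      have h1 : 0 < τ - s := by linarith [hτ.1]
      have h2 : 0 < t - τ := by linarith [hτ.2]
      -- Up to the factor `t - s`, an interior position is a convex combination of `a` and `b` with
      -- positive weights, so it vanishes only if both ends do.
      have h3 : a * (t - τ) + b * (τ - s) = 0 := by
        rw [hq]
        linear_combination (t - s) * hz
      have h4 : 0 ≤ a * (t - τ) := mul_nonneg ha h2.le
      have h5 : 0 ≤ b * (τ - s) := mul_nonneg hb h1.le
      refine h0 ⟨?_, ?_⟩
      · exact (mul_eq_zero.1 (le_antisymm (by linarith) h4)).resolve_right h2.ne'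
      · exact (mul_eq_zero.1 (le_antisymm (by linarith) h5)).resolve_right h1.ne'
    have hl : EqOn (fun τ => lagrangian e L (X τ) (q • e i)) (fun _ => L i q) (Ioo s t) := by
      intro τ hτ
      have h1 : coord e i (X τ) = a + q * (τ - s) :=
        coord_smul_self he hinj i (hpos' τ hτ).le
      simp only
      rw [lagrangian_of_coord_pos he hinj L (hJ τ (Ioo_subset_Icc_self hτ))
        (by rw [h1]; exact hpos' τ hτ), inner_smul_right, real_inner_self_eq_norm_sq, he i]
      simp
    obtain ⟨hi, hv⟩ := intervalIntegrable_of_eqOn_const hst hl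
    refine ⟨X, fun _ => q • e i, ⟨intervalIntegrable_const, hprim, hJ, ?_, hi⟩, hXs, hXt, hv.le⟩
    exact Eventually.of_forall fun τ hτ => Or.inr ⟨i, ⟨_, hpos' τ hτ, rfl⟩, q, rfl⟩

end Trajectories

/-! ### The value function: finiteness, dynamic programming, Lipschitz regularity. -/

section ValueFunction

/-- The standing assumptions on the junction, the Lagrangians and the initial datum. -/
structure IsJunctionProblem {N : ℕ} (e : Fin N → Plane) (L : Fin N → ℝ → ℝ) (γ : ℝ)
    (u₀ : Plane → ℝ) : Prop where
  one_le : 1 ≤ N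
  norm_eq : ∀ i, ‖e i‖ = 1
  injective : Function.Injective e
  pos : 0 < γ
  convex : ∀ i, IsUniformlyConvexC2 γ (L i)
  lipschitz : ∃ K, LipschitzOnWith K u₀ (junction e)

variable {N : ℕ} {e : Fin N → Plane} {L : Fin N → ℝ → ℝ} {u₀ : Plane → ℝ} {γ : ℝ}

theorem integral_mono_on_Ioo_ae {f g : ℝ → ℝ} {a b : ℝ} (hab : a ≤ b)
    (hf : IntervalIntegrable f volume a b) (hg : IntervalIntegrable g volume a b)
    (h : ∀ᵐ τ, τ ∈ Ioo a b → f τ ≤ g τ) : ∫ τ in a..b, f τ ≤ ∫ τ in a..b, g τ := by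
  refine intervalIntegral.integral_mono_ae_restrict hab hf hg ?_
  rw [← restrict_Ioo_eq_restrict_Icc]
  exact (ae_restrict_iff' measurableSet_Ioo).2 h

theorem IsJunctionProblem.exists_superlinear (h : IsJunctionProblem e L γ u₀) (K : ℝ) :
    ∃ C, ∀ i p, K * |p| - C ≤ L i p := by
  choose c hc using fun i => (h.convex i).superlinear h.pos K
  obtain ⟨C, hC⟩ := (Set.finite_range c).bddAbove
  exact ⟨C, fun i p => by linarith [hc i p, hC (mem_range_self i)]⟩

/-- Superlinearity is used with slope equal to the Lipschitz constant of `u₀`: the running cost then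
pays for any change of `u₀` between the two ends, up to `C t`. -/
theorem IsJunctionProblem.exists_le_of_mem_costs (h : IsJunctionProblem e L γ u₀) :
    ∃ C, ∀ t, 0 ≤ t → ∀ x ∈ junction e, ∀ c ∈ costs e L u₀ t x, u₀ x - C * t ≤ c := by
  obtain ⟨K, hK⟩ := h.lipschitz
  obtain ⟨C, hC⟩ := h.exists_superlinear K
  refine ⟨C, fun t ht x hx c hc => ?_⟩
  obtain ⟨X, V, hr, rfl, rfl⟩ := (mem_costs_iff ht hx).1 hc
  have h1 : |u₀ (X t) - u₀ (X 0)| ≤ K * ‖X t - X 0‖ := by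
    have := hK.dist_le_mul _ hx _ (hr.mem 0 ⟨le_rfl, ht⟩)
    rwa [Real.dist_eq, dist_eq_norm] at this
  have h2 : ‖X t - X 0‖ ≤ ∫ τ in (0 : ℝ)..t, ‖V τ‖ := by
    rw [hr.sub_eq_integral ⟨le_rfl, ht⟩ ⟨ht, le_rfl⟩]
    exact intervalIntegral.norm_integral_le_integral_norm ht
  have h3 : ∫ τ in (0 : ℝ)..t, ((K : ℝ) * ‖V τ‖ - C) ≤
      ∫ τ in (0 : ℝ)..t, lagrangian e L (X τ) (V τ) := by
    refine integral_mono_on_Ioo_ae ht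
      ((hr.integrable.norm.const_mul _).sub intervalIntegrable_const) hr.cost ?_
    filter_upwards [hr.control] with τ hτ hm
    exact le_lagrangian h.norm_eq h.injective h.one_le hC (hr.mem τ (Ioo_subset_Icc_self hm))
      (hτ hm)
  rw [intervalIntegral.integral_sub (hr.integrable.norm.const_mul _) intervalIntegrable_const,
    intervalIntegral.integral_const_mul, intervalIntegral.integral_const, smul_eq_mul] at h3
  have h4 : (K : ℝ) * ‖X t - X 0‖ ≤ K * ∫ τ in (0 : ℝ)..t, ‖V τ‖ :=
    mul_le_mul_of_nonneg_left h2 K.2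
  have h5 := (abs_le.1 h1).2
  linarith

theorem IsJunctionProblem.bddBelow_costs (h : IsJunctionProblem e L γ u₀) {t : ℝ} (ht : 0 ≤ t)
    {x : Plane} (hx : x ∈ junction e) : BddBelow (costs e L u₀ t x) := by
  obtain ⟨C, hC⟩ := h.exists_le_of_mem_costs
  exact ⟨_, fun c hc => hC t ht x hx c hc⟩

theorem IsJunctionProblem.exists_mem_costs_le (h : IsJunctionProblem e L γ u₀) {t : ℝ}
    (ht : 0 ≤ t) (i : Fin N) {r : ℝ} (hr : 0 ≤ r) :
    ∃ c ∈ costs e L u₀ t (r • e i), c ≤ u₀ (r • e i) + t * L i 0 := by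
  obtain ⟨X, V, hX, h0, h1, h2⟩ := exists_isRun_segment (L := L) h.norm_eq h.injective i ht hr hr
    (show r = r + 0 * (t - 0) by ring)
  refine ⟨_, (mem_costs_iff ht (smul_mem_junction i hr)).2 ⟨X, V, hX, h1, rfl⟩, ?_⟩
  rw [h0]
  simpa using h2

/-- Standing still provides an element of `costs`, so the `sInf` defining `uoc` is a true infimum
and not a default value. -/
theorem IsJunctionProblem.isGLB_uoc (h : IsJunctionProblem e L γ u₀) {t : ℝ} (ht : 0 ≤ t)
    {x : Plane} (hx : x ∈ junction e) : IsGLB (costs e L u₀ t x) (uoc e L u₀ (t, x)) := by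
  refine isGLB_csInf ?_ (h.bddBelow_costs ht hx)
  obtain ⟨i, r, hr, rfl⟩ := hx
  obtain ⟨c, hc, -⟩ := h.exists_mem_costs_le ht i hr
  exact ⟨c, hc⟩

theorem IsJunctionProblem.exists_abs_uoc_sub_le (h : IsJunctionProblem e L γ u₀) :
    ∃ C, ∀ t, 0 ≤ t → ∀ x ∈ junction e, |uoc e L u₀ (t, x) - u₀ x| ≤ C * t := by
  obtain ⟨C, hC⟩ := h.exists_le_of_mem_costs
  obtain ⟨D, hD⟩ := (Set.finite_range fun i => L i 0).bddAbove
  refine ⟨max C D, fun t ht x hx => abs_le.2 ⟨?_, ?_⟩⟩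
  · have h1 : u₀ x - C * t ≤ uoc e L u₀ (t, x) :=
      (le_isGLB_iff (h.isGLB_uoc ht hx)).2 fun c hc => hC t ht x hx c hc
    have := mul_le_mul_of_nonneg_right (le_max_left C D) ht
    linarith
  · have h1 := (h.isGLB_uoc ht hx).1
    obtain ⟨i, r, hr, rfl⟩ := hx
    obtain ⟨c, hc, hc'⟩ := h.exists_mem_costs_le ht i hr
    have h2 := mul_le_mul_of_nonneg_right ((hD (mem_range_self i)).trans (le_max_right C D)) ht
    linarith [h1 hc, mul_comm t (L i 0)]

theorem IsJunctionProblem.uoc_zero (h : IsJunctionProblem e L γ u₀) {x : Plane}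
    (hx : x ∈ junction e) : uoc e L u₀ (0, x) = u₀ x := by
  obtain ⟨C, hC⟩ := h.exists_abs_uoc_sub_le
  have := hC 0 le_rfl x hx
  rw [mul_zero] at this
  exact sub_eq_zero.1 (abs_eq_zero.1 (le_antisymm this (abs_nonneg _)))

theorem IsJunctionProblem.uoc_le_cost (h : IsJunctionProblem e L γ u₀) {t : ℝ} (ht : 0 ≤ t)
    {X V : ℝ → Plane} (hr : IsRun e L 0 t X V) :
    uoc e L u₀ (t, X t) ≤ u₀ (X 0) + ∫ τ in (0 : ℝ)..t, lagrangian e L (X τ) (V τ) :=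
  (h.isGLB_uoc ht (hr.mem t ⟨ht, le_rfl⟩)).1
    ((mem_costs_iff ht (hr.mem t ⟨ht, le_rfl⟩)).2 ⟨X, V, hr, rfl, rfl⟩)

/-- One half of the dynamic programming principle: any competitor up to time `s` can be continued by
the given run. -/
theorem IsJunctionProblem.uoc_le_of_isRun (h : IsJunctionProblem e L γ u₀) {s t : ℝ} (hs : 0 ≤ s)
    (hst : s ≤ t) {X V : ℝ → Plane} (hr : IsRun e L s t X V) :
    uoc e L u₀ (t, X t) ≤ uoc e L u₀ (s, X s) + ∫ τ in s..t, lagrangian e L (X τ) (V τ) := by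
  have hm := hr.mem s ⟨le_rfl, hst⟩
  rw [← sub_le_iff_le_add]
  refine (le_isGLB_iff (h.isGLB_uoc hs hm)).2 fun c hc => ?_
  obtain ⟨X', V', hr', hX', rfl⟩ := (mem_costs_iff hs hm).1 hc
  obtain ⟨Y, W, hY, h0, h1, h2⟩ := hr'.concat hs hst hr hX'
  have := h.uoc_le_cost (hs.trans hst) hY
  rw [h0, h1, h2] at this
  linarith

theorem IsJunctionProblem.uoc_le_segment (h : IsJunctionProblem e L γ u₀) {s t a b q : ℝ}
    (hs : 0 ≤ s) (hst : s ≤ t) (i : Fin N) (ha : 0 ≤ a) (hb : 0 ≤ b)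
    (hq : b = a + q * (t - s)) :
    uoc e L u₀ (t, b • e i) ≤ uoc e L u₀ (s, a • e i) + (t - s) * L i q := by
  obtain ⟨X, V, hX, h0, h1, h2⟩ := exists_isRun_segment (L := L) h.norm_eq h.injective i hst ha hb hq
  have := h.uoc_le_of_isRun hs hst hX
  rw [h0, h1] at this
  linarith

theorem IsJunctionProblem.exists_uoc_le_uoc_add (h : IsJunctionProblem e L γ u₀) :
    ∃ C, ∀ t, 0 ≤ t → ∀ a, 0 ≤ a → ∀ x ∈ junction e,
      |uoc e L u₀ (t + a, x) - uoc e L u₀ (t, x)| ≤ C * a := by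
  obtain ⟨C, hC⟩ := h.exists_abs_uoc_sub_le
  obtain ⟨D, hD⟩ := (Set.finite_range fun i => L i 0).bddAbove
  refine ⟨max C D, fun t ht a ha x hx => abs_le.2 ⟨?_, ?_⟩⟩
  · have hta : 0 ≤ t + a := add_nonneg ht ha
    have key : uoc e L u₀ (t, x) - C * a ≤ uoc e L u₀ (t + a, x) := by
      refine (le_isGLB_iff (h.isGLB_uoc hta hx)).2 fun c hc => ?_
      obtain ⟨X, V, hr, rfl, rfl⟩ := (mem_costs_iff hta hx).1 hc
      have haa : a ≤ t + a := by linarith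
      -- The run is cut at time `a`. Since the problem is autonomous, the second part shifted by `a`
      -- competes for time `t`, starting from `X a`; the first part changes `u₀` by at most `C a`.
      have r1 := hr.restrict le_rfl ha haa
      have r2 := (hr.restrict ha haa le_rfl).comp_add_right a
      rw [sub_self, add_sub_cancel_right] at r2
      have e1 := h.uoc_le_cost ha r1
      have e2 := h.uoc_le_cost ht r2
      rw [intervalIntegral.integral_comp_add_right
        (fun τ => lagrangian e L (X τ) (V τ)), zero_add] at e2
      have e3 := (abs_le.1 (hC a ha (X a) (hr.mem a ⟨ha, haa⟩))).1
      have e4 := intervalIntegral.integral_add_adjacent_intervals r1.cost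
        (hr.restrict ha haa le_rfl).cost
      linarith
    have := mul_le_mul_of_nonneg_right (le_max_left C D) ha
    linarith
  · obtain ⟨i, r, hr, rfl⟩ := hx
    have h1 := h.uoc_le_segment ht (show t ≤ t + a by linarith) i hr hr
      (show r = r + 0 * (t + a - t) by ring)
    have h2 := mul_le_mul_of_nonneg_right ((hD (mem_range_self i)).trans (le_max_right C D)) ha
    rw [add_sub_cancel_left] at h1
    linarith [mul_comm a (L i 0)]

/-- The value function is Lipschitz continuous on each branch. -/
theorem IsJunctionProblem.exists_lipschitzOnWith_uoc (h : IsJunctionProblem e L γ u₀) (i : Fin N) :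
    ∃ C, LipschitzOnWith C (onBranch e i (uoc e L u₀)) (Ici 0 ×ˢ Ici 0) := by
  obtain ⟨C, hC⟩ := h.exists_uoc_le_uoc_add
  set D : ℝ := max (L i 1) (L i (-1)) with hD
  have hC0 : 0 ≤ C := by
    have := (abs_nonneg _).trans (hC 0 le_rfl 1 zero_le_one 0 (zero_mem_junction i))
    linarith
  have space : ∀ t, 0 ≤ t → ∀ a b : ℝ, 0 ≤ a → 0 ≤ b →
      uoc e L u₀ (t, b • e i) ≤ uoc e L u₀ (t, a • e i) + (C + |D|) * |b - a| := by
    intro t ht a b ha hb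
    -- Going from `a` to `b` at unit speed takes time `δ`; the estimate in time then brings `t + δ`
    -- back to `t`.
    set δ := |b - a| with hδ
    have hδ0 : 0 ≤ δ := abs_nonneg _
    have h1 := (abs_le.1 (hC t ht δ hδ0 _ (smul_mem_junction i hb))).1
    obtain ⟨q, hq, hLq⟩ : ∃ q, b = a + q * (t + δ - t) ∧ L i q ≤ D := by
      rcases le_total a b with hab | hab
      · exact ⟨1, by rw [hδ, abs_of_nonneg (by linarith)]; ring, le_max_left _ _⟩
      · exact ⟨-1, by rw [hδ, abs_of_nonpos (by linarith)]; ring, le_max_right _ _⟩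
    have h2 := h.uoc_le_segment ht (show t ≤ t + δ by linarith) i ha hb hq
    rw [add_sub_cancel_left] at h2
    have h3 := mul_le_mul_of_nonneg_left (hLq.trans (le_abs_self D)) hδ0
    linarith
  have time : ∀ s t, 0 ≤ s → 0 ≤ t → ∀ a : ℝ, 0 ≤ a →
      uoc e L u₀ (t, a • e i) ≤ uoc e L u₀ (s, a • e i) + C * |t - s| := by
    intro s t hs ht a ha
    rcases le_total s t with hst | hst
    · have := (abs_le.1 (hC s hs (t - s) (by linarith) _ (smul_mem_junction i ha))).2
      rw [add_sub_cancel] at this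
      rw [abs_of_nonneg (by linarith)]
      linarith
    · have := (abs_le.1 (hC t ht (s - t) (by linarith) _ (smul_mem_junction i ha))).1
      rw [add_sub_cancel] at this
      rw [abs_of_nonpos (by linarith)]
      linarith
  refine ⟨(C + (C + |D|)).toNNReal, LipschitzOnWith.of_le_add_mul _ ?_⟩
  rintro ⟨t, b⟩ ⟨ht, hb⟩ ⟨s, a⟩ ⟨hs, ha⟩
  simp only [mem_Ici] at ht hb hs ha
  rw [Real.coe_toNNReal _ (by positivity)]
  have h1 := space t ht a b ha hb
  have h2 := time s t hs ht a ha
  have h3 : |t - s| ≤ dist (t, b) (s, a) := le_max_left (dist t s) (dist b a)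
  have h4 : |b - a| ≤ dist (t, b) (s, a) := le_max_right (dist t s) (dist b a)
  have h5 := mul_le_mul_of_nonneg_left h3 hC0
  have h6 := mul_le_mul_of_nonneg_left h4 (show 0 ≤ C + |D| by positivity)
  simp only [onBranch]
  linarith

/-- Continuity on the junction follows from the continuity on each branch. -/
theorem continuousOn_of_onBranch (he : ∀ i, ‖e i‖ = 1) {u : ℝ × Plane → ℝ}
    (h : ∀ i, ContinuousOn (onBranch e i u) (Ici 0 ×ˢ Ici 0)) :
    ContinuousOn u (Ici 0 ×ˢ junction e) := by
  have hray : ∀ i x, (x ∈ {x : Plane | ∃ r : ℝ, 0 ≤ r ∧ x = r • e i}) ↔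
      0 ≤ inner ℝ (e i) x ∧ x = (inner ℝ (e i) x : ℝ) • e i := by
    refine fun i x => ⟨?_, fun hx => ⟨_, hx.1, hx.2⟩⟩
    rintro ⟨r, hr, rfl⟩
    rw [inner_smul_right, real_inner_self_eq_norm_sq, he i]
    simpa using hr
  have hcover : Ici (0 : ℝ) ×ˢ junction e =
      ⋃ i, Ici (0 : ℝ) ×ˢ {x : Plane | ∃ r : ℝ, 0 ≤ r ∧ x = r • e i} := by
    ext ⟨t, x⟩
    simp [junction]
  rw [hcover]
  -- Finitely many closed rays cover `J`, so continuity on each of them glues.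
  refine (locallyFinite_of_finite _).continuousOn_iUnion (fun i => ?_) fun i => ?_
  · refine isClosed_Ici.prod ?_
    have : {x : Plane | ∃ r : ℝ, 0 ≤ r ∧ x = r • e i} =
        {x | 0 ≤ inner ℝ (e i) x} ∩ {x | x = (inner ℝ (e i) x : ℝ) • e i} := Set.ext (hray i)
    rw [this]
    exact (isClosed_le continuous_const (by fun_prop)).inter (isClosed_eq continuous_id (by fun_prop))
  · have hc : ContinuousOn (fun z : ℝ × Plane => onBranch e i u (z.1, inner ℝ (e i) z.2))
        (Ici (0 : ℝ) ×ˢ {x : Plane | ∃ r : ℝ, 0 ≤ r ∧ x = r • e i}) :=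
      (h i).comp (by fun_prop) fun z hz => ⟨hz.1, ((hray i z.2).1 hz.2).1⟩
    refine hc.congr fun z hz => ?_
    simp only [onBranch]
    rw [← ((hray i z.2).1 hz.2).2]

theorem IsJunctionProblem.continuousOn_uoc (h : IsJunctionProblem e L γ u₀) :
    ContinuousOn (uoc e L u₀) (Ici 0 ×ˢ junction e) :=
  continuousOn_of_onBranch h.norm_eq fun i =>
    (h.exists_lipschitzOnWith_uoc i).choose_spec.continuousOn

end ValueFunction

/-! ### Viscosity solutions are sub-optimal along straight lines. -/

section SegmentInequality

variable {γ T : ℝ} {ℓ : ℝ → ℝ} {v : ℝ × ℝ → ℝ}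

theorem deriv_segment_test (C c s K A a q b : ℝ) (n : ℕ) (τ ρ : ℝ) :
    deriv (fun x => C + c * (x - s) + K * ((x - s) / b) ^ n + A * (ρ - (a + q * (x - s))) ^ 2) τ
      = c + K * (n * ((τ - s) / b) ^ (n - 1) * (1 / b)) - 2 * A * q * (ρ - (a + q * (τ - s))) := by
  have h1 : HasDerivAt (fun x : ℝ => x - s) 1 τ := (hasDerivAt_id τ).sub_const s
  have h2 := ((h1.const_mul c).const_add C)
  have h3 := ((h1.div_const b).pow n).const_mul K
  have h4 := ((((h1.const_mul q).const_add a).const_sub ρ).pow 2).const_mul A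
  refine (((h2.add h3).add h4).deriv).trans ?_
  push_cast
  ring

set_option maxHeartbeats 1000000 in
/-- A viscosity solution is sub-optimal along the straight lines in the interior. -/
theorem IsViscositySolution.le_segment (hγ : 0 < γ) (hℓ : IsUniformlyConvexC2 γ ℓ)
    (hv : IsViscositySolution (ham ℓ) (Ioo 0 T ×ˢ Ioi 0) v) {s t a b q : ℝ} (hs : 0 < s)
    (hst : s < t) (ht : t < T) (ha : 0 < a) (hb : 0 < b) (hq : b = a + q * (t - s)) :
    v (t, b) ≤ v (s, a) + (t - s) * ℓ q := by
  by_contra! hcon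
  have hts : 0 < t - s := by linarith
  set D := v (t, b) - v (s, a) - (t - s) * ℓ q with hD
  have hD0 : 0 < D := by linarith
  -- Half of the excess `D` makes the slope strictly larger than `ℓ q`; the other half remains as a
  -- gain at the end of the line.
  set c := ℓ q + D / (2 * (t - s)) with hc
  set line : ℝ → ℝ := fun τ => a + q * (τ - s) with hline
  have hline_pos : ∀ τ ∈ Icc s t, min a b ≤ line τ := by
    intro τ hτ
    rcases le_total 0 q with h | h
    · exact (min_le_left a b).trans (by simp only [hline]; nlinarith [hτ.1])
    · exact (min_le_right a b).trans (by simp only [hline]; rw [hq]; nlinarith [hτ.2])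
  have hmin : 0 < min a b := lt_min ha hb
  set B : Set (ℝ × ℝ) := Icc s t ×ˢ Icc (-(min a b / 2)) (min a b / 2) with hB
  have hmaps : ∀ z ∈ B, (z.1, line z.1 + z.2) ∈ Ioo 0 T ×ˢ Ioi (0 : ℝ) := by
    rintro ⟨τ, y⟩ ⟨hτ, hy⟩
    refine ⟨⟨hs.trans_le hτ.1, hτ.2.trans_lt ht⟩, ?_⟩
    have := hline_pos τ hτ
    simp only [mem_Ioi]
    linarith [hy.1]
  have hvc : ContinuousOn (fun z : ℝ × ℝ => v (z.1, line z.1 + z.2)) B :=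
    hv.1.comp (by fun_prop) hmaps
  -- the amount gained strictly inside the time interval
  obtain ⟨t₁, ht₁, hg⟩ : ∃ t₁ ∈ Ioo s t, D / 4 < v (t₁, line t₁) - v (s, a) - c * (t₁ - s) := by
    have hgc : ContinuousOn (fun τ => v (τ, line τ) - v (s, a) - c * (τ - s)) (Icc s t) := by
      have h1 : ContinuousOn (fun τ => v (τ, line τ + 0)) (Icc s t) :=
        hvc.comp (f := fun τ : ℝ => (τ, (0 : ℝ))) (by fun_prop)
          fun τ hτ => ⟨hτ, by constructor <;> simp only <;> linarith⟩
      simp only [add_zero] at h1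
      exact (h1.sub continuousOn_const).sub (by fun_prop)
    have hend : D / 4 < v (t, line t) - v (s, a) - c * (t - s) := by
      have e1 : line t = b := hq.symm
      have e2 : c * (t - s) = (t - s) * ℓ q + D / 2 := by
        rw [hc]
        field_simp
      rw [e1, e2]
      linarith
    have h2 := (hgc t ⟨hst.le, le_rfl⟩).mono Ioo_subset_Icc_self
    have h3 : ∀ᶠ τ in 𝓝[Ioo s t] t, D / 4 < v (τ, line τ) - v (s, a) - c * (τ - s) :=
      h2.tendsto.eventually (lt_mem_nhds hend)
    have : (𝓝[Ioo s t] t).NeBot := by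
      rw [nhdsWithin_Ioo_eq_nhdsLT hst]
      infer_instance
    obtain ⟨τ, h4, h5⟩ := (h3.and self_mem_nhdsWithin).exists
    exact ⟨τ, h5, h4⟩
  -- The term `D ((τ - s)/(t - s)) ^ n` is negligible at `t₁`, but at `t` it exceeds the gain `D /
  -- 2`. It moves the maximum away from the final time, and since it is nondecreasing in `τ` it does
  -- not harm the strict inequality.
  obtain ⟨n, hn, hn0⟩ : ∃ n : ℕ, D * ((t₁ - s) / (t - s)) ^ n < D / 4 ∧ n ≠ 0 := by
    have h0 : 0 ≤ (t₁ - s) / (t - s) := div_nonneg (by linarith [ht₁.1]) hts.le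
    have h1 : (t₁ - s) / (t - s) < 1 := (div_lt_one hts).2 (by linarith [ht₁.2])
    have h2 := (tendsto_pow_atTop_nhds_zero_of_lt_one h0 h1).const_mul D
    rw [mul_zero] at h2
    obtain ⟨n, h3, h4⟩ := ((h2.eventually (gt_mem_nhds (show 0 < D / 4 by linarith))).and
      (eventually_ge_atTop 1)).exists
    exact ⟨n, h3, by omega⟩
  set ψ : ℝ → ℝ := fun τ => v (s, a) + c * (τ - s) + D * ((τ - s) / (t - s)) ^ n with hψ
  have hψc : Continuous ψ := by fun_prop
  set G : ℝ × ℝ → ℝ := fun z => v (z.1, line z.1 + z.2) - ψ z.1 with hG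
  have hGc : ContinuousOn G B := hvc.sub (by fun_prop)
  have hm0 : 0 < G (t₁, 0) := by
    simp only [hG, hψ, add_zero]
    linarith
  set m := G (t₁, 0) with hm
  have hGs : G (s, 0) < m := by
    refine lt_of_le_of_lt (le_of_eq ?_) hm0
    simp [hG, hψ, hline, hn0]
  have hGt : G (t, 0) < m := by
    refine lt_trans ?_ hm0
    have e1 : line t = b := hq.symm
    have e2 : c * (t - s) = (t - s) * ℓ q + D / 2 := by
      rw [hc]
      field_simp
    simp only [hG, hψ, add_zero, e1, e2, div_self hts.ne', one_pow]
    linarith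
  -- The strip around the line is thin enough that `G` stays below `m` at both end times.
  obtain ⟨κ, hκ0, hκ1, hκs, hκt⟩ : ∃ κ, 0 < κ ∧ κ ≤ min a b / 2 ∧
      (∀ y ∈ Icc (-κ) κ, G (s, y) < m) ∧ ∀ y ∈ Icc (-κ) κ, G (t, y) < m := by
    have key : ∀ τ ∈ Icc s t, G (τ, 0) < m → ∀ᶠ y in 𝓝 (0 : ℝ), G (τ, y) < m := by
      intro τ hτ hlt
      have h1 : ContinuousOn (fun y => G (τ, y)) (Icc (-(min a b / 2)) (min a b / 2)) :=
        hGc.comp (f := fun y : ℝ => (τ, y)) (by fun_prop) fun y hy => ⟨hτ, hy⟩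
      have h2 := h1.continuousAt (Icc_mem_nhds (by linarith : -(min a b / 2) < 0) (by linarith))
      exact h2.tendsto.eventually (gt_mem_nhds hlt)
    obtain ⟨δ, hδ, hball⟩ := Metric.eventually_nhds_iff.1
      ((key s ⟨le_rfl, hst.le⟩ hGs).and (key t ⟨hst.le, le_rfl⟩ hGt))
    have hd : ∀ y ∈ Icc (-(min (δ / 2) (min a b / 2))) (min (δ / 2) (min a b / 2)),
        dist y 0 < δ := by
      intro y hy
      rw [Real.dist_eq, sub_zero]
      have h1 := min_le_left (δ / 2) (min a b / 2)
      have := abs_le.2 hy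
      linarith
    exact ⟨min (δ / 2) (min a b / 2), lt_min (by linarith) (by linarith), min_le_right _ _,
      fun y hy => (hball (hd y hy)).1, fun y hy => (hball (hd y hy)).2⟩
  set Q : Set (ℝ × ℝ) := Icc s t ×ˢ Icc (-κ) κ with hQ
  have hQB : Q ⊆ B := prod_mono le_rfl (Icc_subset_Icc (by linarith) hκ1)
  have hQc : IsCompact Q := isCompact_Icc.prod isCompact_Icc
  have ht₁Q : ((t₁, 0) : ℝ × ℝ) ∈ Q :=
    ⟨Ioo_subset_Icc_self ht₁, by constructor <;> simp only <;> linarith⟩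
  obtain ⟨M, hM⟩ := hQc.bddAbove_image (hGc.mono hQB)
  have hM' : ∀ z ∈ Q, G z ≤ M := fun z hz => hM (mem_image_of_mem G hz)
  -- On the sides `|y| = κ` the penalized function is at most `M - A κ² = m - 1`, so its maximum is
  -- not there.
  set A := (M - m + 1) / κ ^ 2 with hA
  have hAκ : A * κ ^ 2 = M - m + 1 := by
    rw [hA]
    field_simp
  have hA0 : 0 ≤ A := div_nonneg (by linarith [hM' _ ht₁Q]) (by positivity)
  obtain ⟨⟨τ₀, y₀⟩, hzQ, hmax⟩ := hQc.exists_isMaxOn ⟨_, ht₁Q⟩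
    (f := fun z : ℝ × ℝ => G z - A * z.2 ^ 2) ((hGc.mono hQB).sub (by fun_prop))
  have hmax' : ∀ z ∈ Q, G z - A * z.2 ^ 2 ≤ G (τ₀, y₀) - A * y₀ ^ 2 := fun z hz => hmax hz
  have hval : m ≤ G (τ₀, y₀) - A * y₀ ^ 2 := by
    have := hmax' _ ht₁Q
    simp only at this
    linarith
  have hAy : 0 ≤ A * y₀ ^ 2 := by positivity
  have hτs : s < τ₀ := by
    refine lt_of_le_of_ne hzQ.1.1 ?_
    intro heq
    have := hκs y₀ hzQ.2
    rw [heq] at this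
    linarith
  have hτt : τ₀ < t := by
    refine lt_of_le_of_ne hzQ.1.2 ?_
    intro heq
    have := hκt y₀ hzQ.2
    rw [← heq] at this
    linarith
  have hy : |y₀| < κ := by
    refine lt_of_le_of_ne (abs_le.2 hzQ.2) ?_
    intro heq
    have h1 := hM' _ hzQ
    have h2 : y₀ ^ 2 = κ ^ 2 := by rw [← heq, sq_abs]
    rw [h2, hAκ] at hval
    linarith
  -- the test function
  set C := v (τ₀, line τ₀ + y₀) - (ψ τ₀ - v (s, a)) - A * y₀ ^ 2 with hC
  set φ : ℝ × ℝ → ℝ := fun z => C + c * (z.1 - s) + D * ((z.1 - s) / (t - s)) ^ n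
    + A * (z.2 - (a + q * (z.1 - s))) ^ 2 with hφ
  have hφc : ContDiffOn ℝ 1 φ (Ioo 0 T ×ˢ Ioi 0) := by
    apply ContDiff.contDiffOn
    fun_prop
  have hφ0 : v (τ₀, line τ₀ + y₀) = φ (τ₀, line τ₀ + y₀) := by
    simp only [hφ, hC, hψ, hline]
    ring
  have hnear : ∀ᶠ z in 𝓝 (τ₀, line τ₀ + y₀), v z ≤ φ z := by
    have h1 : ∀ᶠ z : ℝ × ℝ in 𝓝 (τ₀, line τ₀ + y₀), z.1 ∈ Ioo s t :=
      continuous_fst.continuousAt.eventually (Ioo_mem_nhds hτs hτt)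
    have h2 : ∀ᶠ z : ℝ × ℝ in 𝓝 (τ₀, line τ₀ + y₀), z.2 - line z.1 ∈ Ioo (-κ) κ := by
      have : Continuous fun z : ℝ × ℝ => z.2 - line z.1 := by fun_prop
      refine this.continuousAt.eventually (Ioo_mem_nhds ?_ ?_)
      · simp only [add_sub_cancel_left]
        exact (abs_lt.1 hy).1
      · simp only [add_sub_cancel_left]
        exact (abs_lt.1 hy).2
    filter_upwards [h1, h2] with z hz1 hz2
    have := hmax' (z.1, z.2 - line z.1) ⟨Ioo_subset_Icc_self hz1, Ioo_subset_Icc_self hz2⟩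
    simp only [hG, add_sub_cancel] at this
    simp only [hφ, hC]
    simp only [hψ, hline] at this ⊢
    linarith
  have hU : (τ₀, line τ₀ + y₀) ∈ Ioo 0 T ×ˢ Ioi (0 : ℝ) := hmaps (τ₀, y₀) (hQB hzQ)
  have hsub := (hv.2 φ hφc τ₀ (line τ₀ + y₀) hU hφ0).1 hnear
  have d1 : deriv (fun x => φ (x, line τ₀ + y₀)) τ₀ =
      c + D * (n * ((τ₀ - s) / (t - s)) ^ (n - 1) * (1 / (t - s))) - 2 * A * q * y₀ := by
    simp only [hφ]
    rw [deriv_segment_test]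
    simp only [hline, add_sub_cancel_left]
  have d2 : deriv (fun ρ => φ (τ₀, ρ)) (line τ₀ + y₀) = 2 * A * y₀ := by
    have h1 : HasDerivAt (fun ρ : ℝ => ρ - (a + q * (τ₀ - s))) 1 (line τ₀ + y₀) :=
      (hasDerivAt_id _).sub_const _
    have h2 := ((h1.pow 2).const_mul A).const_add
      (C + c * (τ₀ - s) + D * ((τ₀ - s) / (t - s)) ^ n)
    simp only [hφ]
    refine h2.deriv.trans ?_
    simp only [hline]
    push_cast
    ring
  rw [d1, d2] at hsub
  -- By Fenchel's inequality with the slope `q` of the line, the transport term `-2 A q y₀` cancels,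
  -- leaving at least `c - ℓ q > 0`.
  have hham := hℓ.le_ham hγ (2 * A * y₀) q
  have hη : 0 ≤ D * (n * ((τ₀ - s) / (t - s)) ^ (n - 1) * (1 / (t - s))) := by
    have : 0 ≤ (τ₀ - s) / (t - s) := div_nonneg (by linarith) hts.le
    positivity
  have hcq : ℓ q < c := by
    have : 0 < D / (2 * (t - s)) := by positivity
    linarith
  linarith

/-- If it is moreover continuous up to the boundary, it is sub-optimal along all straight lines. -/
theorem IsViscositySolution.le_segment_of_continuousOn (hγ : 0 < γ) (hℓ : IsUniformlyConvexC2 γ ℓ)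
    (hv : IsViscositySolution (ham ℓ) (Ioo 0 T ×ˢ Ioi 0) v)
    (hvc : ContinuousOn v (Ico 0 T ×ˢ Ici 0)) {s t a b q : ℝ} (hs : 0 ≤ s)
    (hst : s ≤ t) (ht : t < T) (ha : 0 ≤ a) (hb : 0 ≤ b) (hq : b = a + q * (t - s)) :
    v (t, b) ≤ v (s, a) + (t - s) * ℓ q := by
  rcases hst.eq_or_lt with rfl | hst
  · simp [hq]
  -- Translating both end points by `(ε, ε)` keeps the slope and puts the whole line in the
  -- interior; `t < T` leaves room for small `ε`.
  have lim : ∀ τ ρ, 0 ≤ τ → τ < T → 0 ≤ ρ →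
      Tendsto (fun ε => v (τ + ε, ρ + ε)) (𝓝[>] 0) (𝓝 (v (τ, ρ))) := by
    intro τ ρ hτ hτT hρ
    have h1 : Tendsto (fun ε : ℝ => (τ + ε, ρ + ε)) (𝓝[>] 0) (𝓝[Ico 0 T ×ˢ Ici 0] (τ, ρ)) := by
      refine tendsto_nhdsWithin_iff.2 ⟨?_, ?_⟩
      · have : Continuous fun ε : ℝ => (τ + ε, ρ + ε) := by fun_prop
        have := this.tendsto 0
        simp only [add_zero] at this
        exact this.mono_left nhdsWithin_le_nhds
      · have h2 : ∀ᶠ ε : ℝ in 𝓝[>] 0, ε < T - τ :=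
          nhdsWithin_le_nhds (gt_mem_nhds (by linarith))
        filter_upwards [h2, self_mem_nhdsWithin] with ε h3 h4
        simp only [mem_Ioi] at h4
        exact ⟨⟨by simp only; linarith, by simp only; linarith⟩,
          by simp only [mem_Ici]; linarith⟩
    exact (hvc (τ, ρ) ⟨⟨hτ, hτT⟩, hρ⟩).tendsto.comp h1
  refine le_of_tendsto_of_tendsto (lim t b (hs.trans hst.le) ht hb)
    ((lim s a hs (hst.trans ht) ha).add_const _) ?_
  have h2 : ∀ᶠ ε : ℝ in 𝓝[>] 0, ε < T - t := nhdsWithin_le_nhds (gt_mem_nhds (by linarith))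
  filter_upwards [h2, self_mem_nhdsWithin] with ε h3 h4
  simp only [mem_Ioi] at h4
  have := hv.le_segment hγ hℓ (s := s + ε) (t := t + ε) (a := a + ε) (b := b + ε) (q := q)
    (by linarith) (by linarith) (by linarith) (by linarith) (by linarith) (by rw [hq]; ring)
  rwa [add_sub_add_right_eq_sub] at this

end SegmentInequality

/-! ### Differentiation along trajectories. -/

section Differentiation

/-- Almost everywhere on its zero set, the derivative of a function vanishes when it exists. -/
theorem ae_hasDerivAt_eq_zero {E : Type*} [NormedAddCommGroup E] [NormedSpace ℝ E] (f : ℝ → E) :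
    ∀ᵐ τ, f τ = 0 → ∀ f', HasDerivAt f f' τ → f' = 0 := by
  -- A zero where the derivative is nonzero is isolated from the right in the zero set, and such
  -- points are countable.
  have hc := (countable_setOfPred_isolated_right_within (s := {τ : ℝ | f τ = 0})).ae_notMem
    (volume : Measure ℝ)
  filter_upwards [hc] with τ hτ h0 f' hf'
  by_contra hne
  refine hτ ⟨h0, ?_⟩
  have h1 : ∀ᶠ z in 𝓝[>] τ, f z ≠ 0 :=
    (hf'.eventually_ne hne).filter_mono (nhdsWithin_mono _ fun z hz => ne_of_gt hz)
  rw [inter_comm, nhdsWithin_inter', ← _root_.disjoint_iff, Filter.disjoint_principal_right]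
  exact h1

variable {N : ℕ} {e : Fin N → Plane} {L : Fin N → ℝ → ℝ} {s t : ℝ} {X V : ℝ → Plane}

theorem IsRun.ae_hasDerivAt (h : IsRun e L s t X V) (hst : s ≤ t) :
    ∀ᵐ τ, τ ∈ Ioo s t → HasDerivAt X (V τ) τ := by
  filter_upwards [h.integrable.ae_hasDerivAt_integral] with τ hτ hm
  have h1 := (hτ (by rw [uIcc_of_le hst]; exact Ioo_subset_Icc_self hm) s left_mem_uIcc).const_add
    (X s)
  refine h1.congr_of_eventuallyEq ?_
  filter_upwards [Ioo_mem_nhds hm.1 hm.2] with σ hσ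
  exact h.primitive σ (Ioo_subset_Icc_self hσ)

/-- Increments of `f ∘ X` are dominated by those of `C ∫ ‖V‖`, which is absolutely continuous. -/
theorem IsRun.absolutelyContinuous_comp (h : IsRun e L s t X V) (hst : s ≤ t) {f : Plane → ℝ}
    {C : NNReal} (hf : LipschitzWith C f) :
    AbsolutelyContinuousOnInterval (fun τ => f (X τ)) s t := by
  have hF := (h.integrable.norm.absolutelyContinuousOnInterval_intervalIntegral
    (c := s) left_mem_uIcc).const_mul (C : ℝ)
  unfold AbsolutelyContinuousOnInterval at hF ⊢
  refine squeeze_zero' (Eventually.of_forall fun E => Finset.sum_nonneg fun _ _ => dist_nonneg) ?_ hF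
  have hmem : ∀ᶠ E in AbsolutelyContinuousOnInterval.totalLengthFilter ⊓
      𝓟 (AbsolutelyContinuousOnInterval.disjWithin s t),
      E ∈ AbsolutelyContinuousOnInterval.disjWithin s t :=
    mem_inf_of_right (mem_principal_self _)
  have key : ∀ a ∈ Icc s t, ∀ b ∈ Icc s t, dist (f (X a)) (f (X b)) ≤
      dist (C * ∫ v in s..a, ‖V v‖) (C * ∫ v in s..b, ‖V v‖) := by
    intro a ha b hb
    refine (hf.dist_le_mul _ _).trans ?_
    rw [Real.dist_eq, ← mul_sub, abs_mul, abs_of_nonneg C.coe_nonneg, dist_comm, dist_eq_norm,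
      h.sub_eq_integral ha hb, abs_sub_comm]
    refine mul_le_mul_of_nonneg_left ?_ C.coe_nonneg
    have hi : ∀ c ∈ Icc s t, IntervalIntegrable (fun v => ‖V v‖) volume s c := fun c hc =>
      h.integrable.norm.mono_set (by
        rw [uIcc_of_le hc.1, uIcc_of_le hst]
        exact Icc_subset_Icc_right hc.2)
    rw [intervalIntegral.integral_interval_sub_left (hi b hb) (hi a ha)]
    exact intervalIntegral.norm_integral_le_abs_integral_norm
  filter_upwards [hmem] with E hE
  refine Finset.sum_le_sum fun k hk => ?_
  have := hE.1 k hk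
  rw [uIcc_of_le hst] at this
  exact key _ this.1 _ this.2

end Differentiation

/-! ### Lower bounds for the running cost. -/

section RunningCost

variable {N : ℕ} {e : Fin N → Plane} {L : Fin N → ℝ → ℝ} {u₀ : Plane → ℝ} {γ : ℝ}
  {s t : ℝ} {X V : ℝ → Plane}

theorem IsRun.exists_branch (he : ∀ i, ‖e i‖ = 1) (hinj : Function.Injective e)
    (h : IsRun e L s t X V) (hst : s < t) (h0 : ∀ τ ∈ Ioo s t, X τ ≠ 0) :
    ∃ i, ∀ τ ∈ Ioo s t, 0 < coord e i (X τ) := by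
  have hmid : (s + t) / 2 ∈ Ioo s t := ⟨by linarith, by linarith⟩
  have hJ : ∀ τ ∈ Ioo s t, X τ ∈ junction e := fun τ hτ => h.mem τ (Ioo_subset_Icc_self hτ)
  obtain ⟨i, hi⟩ := exists_coord_pos he hinj (hJ _ hmid) (h0 _ hmid)
  refine ⟨i, fun τ hτ => ?_⟩
  -- On `J` this is positive on the open branch `i`, negative on the other open branches and zero
  -- only at the junction point, so changing branch forces a visit to the junction.
  set g : Plane → ℝ := fun x => coord e i x - ∑ j ∈ Finset.univ.erase i, coord e j x with hg
  have hgc : Continuous g := (continuous_coord e i).sub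
    (continuous_finsetSum _ fun j _ => continuous_coord e j)
  have hgpos : ∀ x ∈ junction e, 0 < coord e i x → 0 < g x := by
    intro x hx hpos
    have : ∑ j ∈ Finset.univ.erase i, coord e j x = 0 := Finset.sum_eq_zero fun j hj =>
      coord_eq_zero_of_ne he hinj hx (Finset.ne_of_mem_erase hj) hpos
    simp only [hg, this, sub_zero]
    exact hpos
  have hgneg : ∀ x ∈ junction e, x ≠ 0 → ¬ 0 < coord e i x → g x < 0 := by
    intro x hx hx0 hpos
    obtain ⟨j, hj⟩ := exists_coord_pos he hinj hx hx0
    have hji : j ≠ i := by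
      rintro rfl
      exact hpos hj
    have h1 := Finset.single_le_sum (f := fun j => coord e j x) (fun k _ => coord_nonneg e k x)
      (Finset.mem_erase.2 ⟨hji, Finset.mem_univ j⟩)
    simp only [hg]
    linarith [not_lt.1 hpos]
  by_contra hneg
  have hcont : ContinuousOn (fun σ => g (X σ)) (Ioo s t) :=
    hgc.comp_continuousOn ((h.continuousOn hst.le).mono Ioo_subset_Icc_self)
  obtain ⟨σ, hσ, hσ0⟩ := isPreconnected_Ioo.intermediate_value hτ hmid hcont
    ⟨(hgneg _ (hJ _ hτ) (h0 _ hτ) hneg).le, (hgpos _ (hJ _ hmid) hi).le⟩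
  simp only at hσ0
  by_cases hp : 0 < coord e i (X σ)
  · exact (hgpos _ (hJ _ hσ) hp).ne' hσ0
  · exact (hgneg _ (hJ _ hσ) (h0 _ hσ) hp).ne hσ0

/-- On a time interval where a trajectory stays in one branch, it costs at least as much as the
straight line. -/
theorem IsRun.segment_le_cost (he : ∀ i, ‖e i‖ = 1) (hinj : Function.Injective e) (hγ : 0 < γ)
    {i : Fin N} (hL : IsUniformlyConvexC2 γ (L i)) (h : IsRun e L s t X V) (hst : s < t)
    (hi : ∀ τ ∈ Ioo s t, 0 < coord e i (X τ)) :
    X s = coord e i (X s) • e i ∧ X t = coord e i (X t) • e i ∧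
      (t - s) * L i ((coord e i (X t) - coord e i (X s)) / (t - s)) ≤
        ∫ τ in s..t, lagrangian e L (X τ) (V τ) := by
  have hXc := h.continuousOn hst.le
  have heq : EqOn X (fun τ => coord e i (X τ) • e i) (Icc s t) := by
    refine EqOn.of_subset_closure (s := Ioo s t) (fun τ hτ => ?_) hXc
      (((continuous_coord e i).comp_continuousOn hXc).smul continuousOn_const)
      Ioo_subset_Icc_self (by rw [closure_Ioo hst.ne])
    exact eq_coord_smul he hinj (h.mem τ (Ioo_subset_Icc_self hτ)) (hi τ hτ)
  have hs : s ∈ Icc s t := ⟨le_rfl, hst.le⟩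
  have ht : t ∈ Icc s t := ⟨hst.le, le_rfl⟩
  refine ⟨heq hs, heq ht, ?_⟩
  set q := (coord e i (X t) - coord e i (X s)) / (t - s) with hq
  have hts : t - s ≠ 0 := by linarith
  have hVi : IntervalIntegrable (fun τ => (inner ℝ (e i) (V τ) : ℝ)) volume s t :=
    ⟨(innerSL ℝ (e i)).integrable_comp h.integrable.1,
      (innerSL ℝ (e i)).integrable_comp h.integrable.2⟩
  have hint : ∫ τ in s..t, (inner ℝ (e i) (V τ) : ℝ) = q * (t - s) := by
    have h1 := (innerSL ℝ (e i)).intervalIntegral_comp_comm h.integrable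
    simp only [innerSL_apply_apply] at h1
    rw [h1, ← h.sub_eq_integral hs ht]
    conv_lhs => rw [heq hs, heq ht]
    rw [← sub_smul, inner_smul_right, real_inner_self_eq_norm_sq, he i, hq]
    field_simp
  -- Jensen's inequality by the tangent at the mean velocity `q`, whose linear term integrates to
  -- zero.
  have hle : ∫ τ in s..t, (L i q + deriv (L i) q * (inner ℝ (e i) (V τ) - q)) ≤
      ∫ τ in s..t, lagrangian e L (X τ) (V τ) := by
    refine integral_mono_on_Ioo_ae hst.le (intervalIntegrable_const.add
      ((hVi.sub intervalIntegrable_const).const_mul _)) h.cost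
      (Eventually.of_forall fun τ hτ => ?_)
    rw [lagrangian_of_coord_pos he hinj L (h.mem τ (Ioo_subset_Icc_self hτ)) (hi τ hτ)]
    exact hL.tangent_le hγ q _
  rw [intervalIntegral.integral_add intervalIntegrable_const
      ((hVi.sub intervalIntegrable_const).const_mul _), intervalIntegral.integral_const_mul,
    intervalIntegral.integral_sub hVi intervalIntegrable_const, hint,
    intervalIntegral.integral_const, intervalIntegral.integral_const, smul_eq_mul,
    smul_eq_mul] at hle
  linarith

/-- A trajectory from the junction point to itself costs at least as much as staying there. -/
theorem IsRun.stay_le_cost (he : ∀ i, ‖e i‖ = 1) (hinj : Function.Injective e) (hγ : 0 < γ)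
    (hL : ∀ i, IsUniformlyConvexC2 γ (L i)) (h : IsRun e L s t X V) (hst : s ≤ t)
    (hs : X s = 0) (ht : X t = 0) :
    (t - s) * (⨅ j, L j 0) ≤ ∫ τ in s..t, lagrangian e L (X τ) (V τ) := by
  have hac : ∀ i, AbsolutelyContinuousOnInterval (fun τ => coord e i (X τ)) s t := fun i =>
    h.absolutelyContinuous_comp hst (exists_lipschitzWith_coord e i).choose_spec
  have hzero : ∀ᵐ τ, ∀ i, coord e i (X τ) = 0 →
      ∀ f', HasDerivAt (fun τ => coord e i (X τ)) f' τ → f' = 0 :=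
    ae_all_iff.2 fun i => ae_hasDerivAt_eq_zero fun τ => coord e i (X τ)
  have hdiff : ∀ᵐ τ, ∀ i, τ ∈ uIcc s t → DifferentiableAt ℝ (fun τ => coord e i (X τ)) τ :=
    ae_all_iff.2 fun i => (hac i).ae_differentiableAt
  have hint : ∀ i, IntervalIntegrable
      (fun τ => deriv (L i) 0 * deriv (fun τ => coord e i (X τ)) τ) volume s t :=
    fun i => (hac i).intervalIntegrable_deriv.const_mul _
  have hsum : IntervalIntegrable
      (fun τ => ∑ i, deriv (L i) 0 * deriv (fun τ => coord e i (X τ)) τ) volume s t :=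
    (IntervalIntegrable.sum Finset.univ fun i _ => hint i).congr fun τ _ => by simp
  -- Tangents at `0`, all branches at once: almost everywhere at most one coordinate has a nonzero
  -- derivative, and when `X τ = 0` the velocity vanishes too. Each coordinate runs from `0` to `0`,
  -- so the sum has zero integral.
  have hle : ∫ τ in s..t, ((⨅ j, L j 0) +
      ∑ i, deriv (L i) 0 * deriv (fun τ => coord e i (X τ)) τ) ≤
        ∫ τ in s..t, lagrangian e L (X τ) (V τ) := by
    refine integral_mono_on_Ioo_ae hst (intervalIntegrable_const.add hsum) h.cost ?_
    filter_upwards [hzero, hdiff, ae_hasDerivAt_eq_zero X, h.ae_hasDerivAt hst]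
      with τ hz hd hX hV hτ
    have hτI := Ioo_subset_Icc_self hτ
    have hd' : ∀ i, coord e i (X τ) = 0 → deriv (fun τ => coord e i (X τ)) τ = 0 :=
      fun i h0 => hz i h0 _ (hd i (by rwa [uIcc_of_le hst])).hasDerivAt
    by_cases h0 : X τ = 0
    · rw [Finset.sum_eq_zero fun i _ => by rw [hd' i (by rw [h0, coord_zero]), mul_zero], h0,
        lagrangian_zero, hX h0 _ (hV hτ), norm_zero, add_zero]
    · obtain ⟨i, hi⟩ := exists_coord_pos he hinj (h.mem τ hτI) h0
      rw [Finset.sum_eq_single i, lagrangian_of_coord_pos he hinj L (h.mem τ hτI) hi]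
      · have h1 : HasDerivAt (fun σ => (inner ℝ (e i) (X σ) : ℝ)) (inner ℝ (e i) (V τ)) τ :=
          (innerSL ℝ (e i)).hasFDerivAt.comp_hasDerivAt τ (hV hτ)
        have h2 : HasDerivAt (fun σ => coord e i (X σ)) (inner ℝ (e i) (V τ)) τ := by
          refine h1.congr_of_eventuallyEq ?_
          have h3 : ∀ᶠ σ in 𝓝 τ, 0 < coord e i (X σ) :=
            ((continuous_coord e i).continuousAt.comp (hV hτ).continuousAt).tendsto.eventually
              (lt_mem_nhds hi)
          filter_upwards [h3, Ioo_mem_nhds hτ.1 hτ.2] with σ hσ hσI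
          conv_rhs => rw [eq_coord_smul he hinj (h.mem σ (Ioo_subset_Icc_self hσI)) hσ]
          rw [inner_smul_right, real_inner_self_eq_norm_sq, he i]
          simp
        rw [h2.deriv]
        have h4 := (hL i).tangent_le hγ 0 (inner ℝ (e i) (V τ))
        have h5 : ⨅ j, L j 0 ≤ L i 0 := ciInf_le (Set.finite_range _).bddBelow i
        rw [sub_zero] at h4
        linarith
      · intro j _ hji
        rw [hd' j (coord_eq_zero_of_ne he hinj (h.mem τ hτI) hji hi), mul_zero]
      · simp
  rw [intervalIntegral.integral_add intervalIntegrable_const hsum,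
    intervalIntegral.integral_finsetSum fun i _ => hint i, intervalIntegral.integral_const,
    smul_eq_mul, Finset.sum_eq_zero fun i _ => ?_, add_zero] at hle
  · exact hle
  · rw [intervalIntegral.integral_const_mul, (hac i).integral_deriv_eq_sub, hs, ht, sub_self,
      mul_zero]

/-- A function which is sub-optimal along the straight lines in each branch is sub-optimal along
all trajectories. -/
theorem IsRun.le_add_cost (hN : 1 ≤ N) (he : ∀ i, ‖e i‖ = 1) (hinj : Function.Injective e)
    (hγ : 0 < γ) (hL : ∀ i, IsUniformlyConvexC2 γ (L i)) {u : ℝ × Plane → ℝ} {T : ℝ}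
    (hu : ∀ i, ∀ s t a b q : ℝ, 0 ≤ s → s ≤ t → t < T → 0 ≤ a → 0 ≤ b → b = a + q * (t - s) →
      u (t, b • e i) ≤ u (s, a • e i) + (t - s) * L i q)
    (h : IsRun e L s t X V) (hs : 0 ≤ s) (hst : s ≤ t) (ht : t < T) :
    u (t, X t) ≤ u (s, X s) + ∫ τ in s..t, lagrangian e L (X τ) (V τ) := by
  have hne : Nonempty (Fin N) := ⟨⟨0, hN⟩⟩
  have away : ∀ a b, s ≤ a → a ≤ b → b ≤ t → (∀ τ ∈ Ioo a b, X τ ≠ 0) →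
      u (b, X b) ≤ u (a, X a) + ∫ τ in a..b, lagrangian e L (X τ) (V τ) := by
    intro a b ha hab hb h0
    rcases hab.eq_or_lt with rfl | hab
    · simp
    have hr := h.restrict ha hab.le hb
    obtain ⟨i, hi⟩ := hr.exists_branch he hinj hab h0
    obtain ⟨h1, h2, h3⟩ := hr.segment_le_cost he hinj hγ (hL i) hab hi
    have h4 := hu i a b _ _ ((coord e i (X b) - coord e i (X a)) / (b - a)) (hs.trans ha) hab.le
      (hb.trans_lt ht) (coord_nonneg e i (X a)) (coord_nonneg e i (X b)) (by
        rw [div_mul_cancel₀ _ (by linarith)]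
        ring)
    rw [← h1, ← h2] at h4
    linarith
  have stay : ∀ a b, s ≤ a → a ≤ b → b ≤ t → X a = 0 → X b = 0 →
      u (b, X b) ≤ u (a, X a) + ∫ τ in a..b, lagrangian e L (X τ) (V τ) := by
    intro a b ha hab hb h1 h2
    have h3 := (h.restrict ha hab hb).stay_le_cost he hinj hγ hL hab h1 h2
    obtain ⟨j, hj⟩ := exists_eq_ciInf_of_finite (f := fun j => L j 0)
    have h4 := hu j a b 0 0 0 (hs.trans ha) hab (hb.trans_lt ht) le_rfl le_rfl (by ring)
    rw [zero_smul] at h4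
    rw [h1, h2]
    rw [← hj] at h3
    linarith
  -- Compactness gives a first and a last visit to the junction point.
  have hZ : IsCompact (Icc s t ∩ X ⁻¹' {0}) :=
    isCompact_Icc.of_isClosed_subset ((h.continuousOn hst).preimage_isClosed_of_isClosed
      isClosed_Icc isClosed_singleton) inter_subset_left
  rcases (Icc s t ∩ X ⁻¹' {0}).eq_empty_or_nonempty with hemp | hnon
  · refine away s t le_rfl hst le_rfl fun τ hτ h0 => ?_
    have : τ ∈ Icc s t ∩ X ⁻¹' {0} := ⟨Ioo_subset_Icc_self hτ, h0⟩
    rw [hemp] at this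
    exact this
  · obtain ⟨a, ha, hamin⟩ := hZ.exists_isLeast hnon
    obtain ⟨b, hb, hbmax⟩ := hZ.exists_isGreatest hnon
    have hab : a ≤ b := hamin hb
    have h1 := away s a le_rfl ha.1.1 ha.1.2 fun τ hτ h0 =>
      absurd (hamin ⟨⟨hτ.1.le, hτ.2.le.trans ha.1.2⟩, h0⟩) (not_le.2 hτ.2)
    have h2 := stay a b ha.1.1 hab hb.1.2 ha.2 hb.2
    have h3 := away b t hb.1.1 hb.1.2 le_rfl fun τ hτ h0 =>
      absurd (hbmax ⟨⟨hb.1.1.trans hτ.1.le, hτ.2.le⟩, h0⟩) (not_le.2 hτ.1)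
    have r1 := (h.restrict le_rfl ha.1.1 ha.1.2).cost
    have r2 := (h.restrict ha.1.1 hab hb.1.2).cost
    have r3 := (h.restrict hb.1.1 hb.1.2 le_rfl).cost
    have e1 := intervalIntegral.integral_add_adjacent_intervals r1 r2
    have e2 := intervalIntegral.integral_add_adjacent_intervals (r1.trans r2) r3
    linarith

end RunningCost

/-! ### Derivatives of test functions along lines. -/

section TestFunctions

variable {φ : ℝ × ℝ → ℝ} {A : ℝ × ℝ →L[ℝ] ℝ} {S : Set (ℝ × ℝ)} {t r : ℝ}

/-- One-sided difference quotient along the backward path `(t - h, r - q h)`; it only needs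
differentiability within a set containing that path, so it also applies at the junction. -/
theorem fderiv_apply_le_of_eventually_le {q c : ℝ} (hA : HasFDerivWithinAt φ A S (t, r))
    (hS : ∀ᶠ h in 𝓝[>] (0 : ℝ), (t - h, r - q * h) ∈ S)
    (hle : ∀ᶠ h in 𝓝[>] (0 : ℝ), φ (t, r) ≤ φ (t - h, r - q * h) + h * c) : A (1, q) ≤ c := by
  set g : ℝ → ℝ × ℝ := fun h => (t - h, r - q * h) with hg
  have hg0 : g 0 = (t, r) := by simp [hg]
  have hgd : HasDerivAt g (-1, -q) 0 := by
    have h1 : HasDerivAt (fun h : ℝ => t - h) (-1) 0 := (hasDerivAt_id (0 : ℝ)).const_sub t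
    have h2 : HasDerivAt (fun h : ℝ => r - q * h) (-q) 0 := by
      have := ((hasDerivAt_id (0 : ℝ)).const_mul q).const_sub r
      simpa using this
    exact h1.prodMk h2
  have h1 : HasDerivWithinAt (φ ∘ g) (A (-1, -q)) (Ioi 0 ∩ g ⁻¹' S) 0 :=
    hA.comp_hasDerivWithinAt_of_eq 0 hgd.hasDerivWithinAt (fun h hh => hh.2) hg0.symm
  have h2 : HasDerivWithinAt (φ ∘ g) (A (-1, -q)) (Ioi 0) 0 :=
    h1.mono_of_mem_nhdsWithin (inter_mem self_mem_nhdsWithin hS)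
  rw [hasDerivWithinAt_iff_tendsto_slope' (by simp)] at h2
  have h3 : -c ≤ A (-1, -q) := by
    refine ge_of_tendsto h2 ?_
    filter_upwards [hle, self_mem_nhdsWithin] with h hh hpos
    simp only [mem_Ioi] at hpos
    rw [slope_def_field, sub_zero, le_div_iff₀ hpos, Function.comp_apply, Function.comp_apply, hg0]
    simp only [hg]
    linarith
  have h4 : A (-1, -q) = -A (1, q) := by
    rw [← map_neg]
    simp
  linarith

theorem deriv_fst_eq (hA : HasFDerivWithinAt φ A S (t, r)) (hS : ∀ᶠ s in 𝓝 t, (s, r) ∈ S) :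
    deriv (fun s => φ (s, r)) t = A (1, 0) := by
  have h1 : HasDerivAt (fun s : ℝ => (s, r)) (1, 0) t := (hasDerivAt_id t).prodMk (hasDerivAt_const t r)
  have h2 : HasDerivWithinAt (φ ∘ fun s => (s, r)) (A (1, 0)) ((fun s : ℝ => (s, r)) ⁻¹' S) t :=
    hA.comp_hasDerivWithinAt t h1.hasDerivWithinAt fun s hs => hs
  exact (h2.hasDerivAt hS).deriv

theorem derivWithin_snd_eq {R : Set ℝ} (hA : HasFDerivWithinAt φ A S (t, r))
    (hS : ∀ ρ ∈ R, (t, ρ) ∈ S) (hR : UniqueDiffWithinAt ℝ R r) :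
    derivWithin (fun ρ => φ (t, ρ)) R r = A (0, 1) := by
  have h1 : HasDerivAt (fun ρ : ℝ => (t, ρ)) (0, 1) r := (hasDerivAt_const r t).prodMk (hasDerivAt_id r)
  have h2 : HasDerivWithinAt (φ ∘ fun ρ => (t, ρ)) (A (0, 1)) R r :=
    hA.comp_hasDerivWithinAt r h1.hasDerivWithinAt hS
  exact h2.derivWithin hR

theorem deriv_snd_eq (hA : HasFDerivAt φ A (t, r)) : deriv (fun ρ => φ (t, ρ)) r = A (0, 1) := by
  have := derivWithin_snd_eq (R := univ) hA.hasFDerivWithinAt (S := univ) (fun _ _ => mem_univ _)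
    uniqueDiffWithinAt_univ
  rwa [derivWithin_univ] at this

theorem apply_eq_add_mul (A : ℝ × ℝ →L[ℝ] ℝ) (p q : ℝ) : A (p, q) = p * A (1, 0) + q * A (0, 1) := by
  have : ((p, q) : ℝ × ℝ) = p • (1, 0) + q • (0, 1) := by simp
  rw [this, map_add, map_smul, map_smul, smul_eq_mul, smul_eq_mul]

end TestFunctions

/-! ### Branchwise solutions: sub-solution property and comparison with the value function. -/

section Subsolution

variable {N : ℕ} {e : Fin N → Plane} {L : Fin N → ℝ → ℝ} {u₀ : Plane → ℝ} {γ T : ℝ}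
  {u : ℝ × Plane → ℝ}

theorem IsBranchwiseSolution.le_segment (hγ : 0 < γ) (hL : ∀ i, IsUniformlyConvexC2 γ (L i))
    (hu : IsBranchwiseSolution e L T u₀ u) (i : Fin N) (s t a b q : ℝ) (hs : 0 ≤ s) (hst : s ≤ t)
    (ht : t < T) (ha : 0 ≤ a) (hb : 0 ≤ b) (hq : b = a + q * (t - s)) :
    u (t, b • e i) ≤ u (s, a • e i) + (t - s) * L i q := by
  have hc : ContinuousOn (onBranch e i u) (Ico 0 T ×ˢ Ici 0) :=
    hu.1.comp (f := fun z : ℝ × ℝ => (z.1, z.2 • e i)) (by fun_prop)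
      fun z hz => ⟨hz.1, smul_mem_junction i hz.2⟩
  exact (hu.2.2 i).le_segment_of_continuousOn hγ (hL i) hc hs hst ht ha hb hq

theorem eventually_sub_mem {t r q : ℝ} (ht : t ∈ Ioo 0 T) (hr : 0 ≤ r) (hq : 0 < r ∨ q ≤ 0) :
    ∀ᶠ h in 𝓝[>] (0 : ℝ), (t - h, r - q * h) ∈ Ioo 0 T ×ˢ Ici (0 : ℝ) := by
  have h1 : ∀ᶠ h in 𝓝[>] (0 : ℝ), h < t := nhdsWithin_le_nhds (gt_mem_nhds ht.1)
  have h2 : ∀ᶠ h in 𝓝[>] (0 : ℝ), 0 ≤ r - q * h := by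
    rcases hq with hr | hq
    · have : Tendsto (fun h : ℝ => r - q * h) (𝓝 0) (𝓝 (r - q * 0)) :=
        (by fun_prop : Continuous fun h : ℝ => r - q * h).tendsto 0
      rw [mul_zero, sub_zero] at this
      exact nhdsWithin_le_nhds ((this.eventually (lt_mem_nhds hr)).mono fun h hh => le_of_lt hh)
    · filter_upwards [self_mem_nhdsWithin] with h hh
      simp only [mem_Ioi] at hh
      nlinarith
  filter_upwards [h1, h2, self_mem_nhdsWithin] with h hh1 hh2 hh3
  simp only [mem_Ioi] at hh3
  exact ⟨⟨by simp only; linarith, by simp only; linarith [ht.2]⟩, hh2⟩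

/-- The condition `0 < r ∨ q ≤ 0` keeps the backward line of slope `q` in the closed branch for
short times. At `r = 0` it selects exactly the velocities in the definition of `hamMinus`. -/
theorem test_add_mul_le {i : Fin N} (hu : ∀ s t a b q : ℝ, 0 ≤ s → s ≤ t → t < T → 0 ≤ a → 0 ≤ b →
      b = a + q * (t - s) → u (t, b • e i) ≤ u (s, a • e i) + (t - s) * L i q)
    {φ : ℝ × Plane → ℝ} (hφ : IsC1Star e T φ) {t r q : ℝ} (ht : t ∈ Ioo 0 T) (hr : 0 ≤ r)
    (heq : u (t, r • e i) = φ (t, r • e i))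
    (hle : ∀ᶠ z in 𝓝[Ioo 0 T ×ˢ junction e] (t, r • e i), u z ≤ φ z) (hq : 0 < r ∨ q ≤ 0) :
    timeDeriv φ t (r • e i) + (branchDeriv e i φ t r * q - L i q) ≤ 0 := by
  obtain ⟨A, hA⟩ := (hφ.2 i).differentiableOn one_ne_zero (t, r) ⟨ht, hr⟩
  have hS := eventually_sub_mem (q := q) ht hr hq
  have htend : Tendsto (fun h : ℝ => (t - h, (r - q * h) • e i)) (𝓝[>] 0)
      (𝓝[Ioo 0 T ×ˢ junction e] (t, r • e i)) := by
    refine tendsto_nhdsWithin_iff.2 ⟨?_, ?_⟩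
    · have : Continuous fun h : ℝ => (t - h, (r - q * h) • e i) := by fun_prop
      have := this.tendsto 0
      simp only [mul_zero, sub_zero] at this
      exact this.mono_left nhdsWithin_le_nhds
    · filter_upwards [hS] with h hh
      exact ⟨hh.1, smul_mem_junction i hh.2⟩
  have h1 : A (1, q) ≤ L i q := by
    refine fderiv_apply_le_of_eventually_le hA hS ?_
    filter_upwards [hS, htend.eventually hle, self_mem_nhdsWithin] with h hh hh2 hpos
    simp only [mem_Ioi] at hpos
    have := hu (t - h) t (r - q * h) r q hh.1.1.le (by linarith) ht.2 hh.2 hr (by ring)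
    rw [sub_sub_cancel] at this
    simp only [onBranch]
    linarith
  have e1 : timeDeriv φ t (r • e i) = A (1, 0) := by
    refine deriv_fst_eq (φ := onBranch e i φ) hA ?_
    filter_upwards [Ioo_mem_nhds ht.1 ht.2] with s hs
    exact ⟨hs, hr⟩
  have e2 : branchDeriv e i φ t r = A (0, 1) :=
    derivWithin_snd_eq hA (fun ρ hρ => ⟨ht, hρ⟩) (uniqueDiffOn_Ici 0 r hr)
  rw [e1, e2]
  rw [apply_eq_add_mul] at h1
  linarith

theorem IsBranchwiseSolution.isSubsolution (hN : 1 ≤ N) (hγ : 0 < γ)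
    (hL : ∀ i, IsUniformlyConvexC2 γ (L i)) (hu : IsBranchwiseSolution e L T u₀ u) :
    IsSubsolution e L T u₀ u := by
  have hne : Nonempty (Fin N) := ⟨⟨0, hN⟩⟩
  refine ⟨hu.1.upperSemicontinuousOn, fun φ hφ t ht x hx heq hle => ⟨?_, ?_⟩,
    fun x hx => (hu.2.1 x hx).le⟩
  · rintro i r hr rfl
    have : ham (L i) (branchDeriv e i φ t r) ≤ -timeDeriv φ t (r • e i) := ciSup_le fun q => by
      have := test_add_mul_le (hu.le_segment hγ hL i) hφ (q := q) ht hr.le heq hle (Or.inl hr)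
      linarith
    linarith
  · rintro rfl
    have : ⨆ i, hamMinus (L i) (branchDeriv e i φ t 0) ≤ -timeDeriv φ t 0 :=
      ciSup_le fun i => ciSup_le fun q => by
        have := test_add_mul_le (hu.le_segment hγ hL i) hφ (q := q) (r := 0) ht le_rfl
          (by rwa [zero_smul]) (by rwa [zero_smul]) (Or.inr q.2)
        rw [zero_smul] at this
        linarith
    linarith

theorem IsBranchwiseSolution.le_uoc (h : IsJunctionProblem e L γ u₀)
    (hu : IsBranchwiseSolution e L T u₀ u) {t : ℝ} (ht : t ∈ Ico 0 T) {x : Plane}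
    (hx : x ∈ junction e) : u (t, x) ≤ uoc e L u₀ (t, x) := by
  refine (le_isGLB_iff (h.isGLB_uoc ht.1 hx)).2 fun c hc => ?_
  obtain ⟨X, V, hr, rfl, rfl⟩ := (mem_costs_iff ht.1 hx).1 hc
  rw [← hu.2.1 _ (hr.mem 0 ⟨le_rfl, ht.1⟩)]
  exact hr.le_add_cost h.one_le h.norm_eq h.injective h.pos h.convex (hu.le_segment h.pos h.convex)
    le_rfl ht.1 ht.2

end Subsolution

/-! ### The value function solves the equation on each open branch. -/

section ValueFunctionSolution

variable {N : ℕ} {e : Fin N → Plane} {L : Fin N → ℝ → ℝ} {u₀ : Plane → ℝ} {γ : ℝ}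

/-- A trajectory ending at `r e_i` at time `t` stays in the branch `i`, and close to `r e_i`, from
a time at which `(τ, X τ)` is at distance `δ` from `(t, r e_i)`. -/
theorem IsRun.exists_last_exit {X V : ℝ → Plane} {t r δ : ℝ} {i : Fin N} (h : IsRun e L 0 t X V)
    (hXt : coord e i (X t) = r) (hδ : 0 < δ) (hδt : δ ≤ t) :
    ∃ s, 0 ≤ s ∧ s < t ∧ max |s - t| |coord e i (X s) - r| = δ ∧
      ∀ τ ∈ Ioo s t, |coord e i (X τ) - r| < δ := by
  have ht : 0 ≤ t := hδ.le.trans hδt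
  set m : ℝ → ℝ := fun τ => max |τ - t| |coord e i (X τ) - r| with hm
  have hmc : ContinuousOn m (Icc 0 t) := by
    refine ContinuousOn.sup (by fun_prop) ?_
    exact (((continuous_coord e i).comp_continuousOn (h.continuousOn ht)).sub
      continuousOn_const).abs
  have hE : IsCompact (Icc 0 t ∩ m ⁻¹' Ici δ) :=
    isCompact_Icc.of_isClosed_subset (hmc.preimage_isClosed_of_isClosed isClosed_Icc isClosed_Ici)
      inter_subset_left
  have h0 : (0 : ℝ) ∈ Icc 0 t ∩ m ⁻¹' Ici δ := by
    refine ⟨⟨le_rfl, ht⟩, show δ ≤ m 0 from le_max_of_le_left ?_⟩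
    rwa [zero_sub, abs_neg, abs_of_nonneg ht]
  obtain ⟨s, hs, hsmax⟩ := hE.exists_isGreatest ⟨0, h0⟩
  have hst : s < t := by
    refine lt_of_le_of_ne hs.1.2 ?_
    rintro rfl
    have := hs.2
    simp only [hm, mem_preimage, sub_self, hXt, abs_zero, max_self, mem_Ici] at this
    linarith
  have hlt : ∀ τ ∈ Ioo s t, m τ < δ := by
    intro τ hτ
    by_contra hge
    exact absurd (hsmax ⟨⟨hs.1.1.trans hτ.1.le, hτ.2.le⟩, not_lt.1 hge⟩) (not_le.2 hτ.1)
  -- The distance is below `δ` right after `s`, so by continuity it is at most `δ` at `s`.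
  refine ⟨s, hs.1.1, hst, le_antisymm ?_ hs.2, fun τ hτ => (le_max_right _ _).trans_lt (hlt τ hτ)⟩
  have hcl : closure (Ioo s t) = Icc s t := closure_Ioo hst.ne
  refine le_on_closure (f := m) (g := fun _ => δ) (fun τ hτ => (hlt τ hτ).le) ?_
    continuousOn_const ?_
  · rw [hcl]
    exact hmc.mono (Icc_subset_Icc_left hs.1.1)
  · rw [hcl]
    exact ⟨le_rfl, hst.le⟩

/-- Strictness at the contact point leaves room to subtract the squared distance to it: the modified
test function is still a strict sub-solution nearby, and now has a definite gap on the sphere. -/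
theorem exists_closedBall_strict {H : ℝ → ℝ} (hH : Continuous H) {U : Set (ℝ × ℝ)} (hU : IsOpen U)
    {φ v : ℝ × ℝ → ℝ} (hφ : ContDiffOn ℝ 1 φ U) {t r : ℝ} (hz : (t, r) ∈ U)
    (hneg : fderiv ℝ φ (t, r) (1, 0) + H (fderiv ℝ φ (t, r) (0, 1)) < 0)
    (hle : ∀ᶠ z in 𝓝 (t, r), φ z ≤ v z) :
    ∃ δ, 0 < δ ∧ ∀ z ∈ Metric.closedBall (t, r) δ, z ∈ U ∧ φ z ≤ v z ∧
      fderiv ℝ φ z (1, 0) - 2 * (z.1 - t) + H (fderiv ℝ φ z (0, 1) - 2 * (z.2 - r)) < 0 := by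
  have hc : ContinuousAt (fderiv ℝ φ) (t, r) :=
    (hφ.continuousOn_fderiv_of_isOpen hU le_rfl).continuousAt (hU.mem_nhds hz)
  have hF : ContinuousAt (fun z : ℝ × ℝ => fderiv ℝ φ z (1, 0) - 2 * (z.1 - t) +
      H (fderiv ℝ φ z (0, 1) - 2 * (z.2 - r))) (t, r) := by
    refine ((hc.clm_apply continuousAt_const).sub (by fun_prop)).add (hH.continuousAt.comp ?_)
    exact (hc.clm_apply continuousAt_const).sub (by fun_prop)
  have h1 := hF.tendsto.eventually (gt_mem_nhds (show
    fderiv ℝ φ (t, r) (1, 0) - 2 * (t - t) + H (fderiv ℝ φ (t, r) (0, 1) - 2 * (r - r)) < 0 by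
      simpa using hneg))
  have h2 := (hU.eventually_mem hz).and (hle.and h1)
  obtain ⟨δ, hδ, hb⟩ := Metric.nhds_basis_closedBall.eventually_iff.1 h2
  exact ⟨δ, hδ, fun z hz => hb hz⟩

/-- By Fenchel's inequality, a classical strict sub-solution grows along a line of slope `q` at rate
at most `ℓ q`; the mean value inequality integrates this. -/
theorem sub_sq_le_segment {ℓ : ℝ → ℝ} (hγ : 0 < γ) (hℓ : IsUniformlyConvexC2 γ ℓ)
    {U : Set (ℝ × ℝ)} (hU : IsOpen U) {φ : ℝ × ℝ → ℝ} (hφ : ContDiffOn ℝ 1 φ U) {t r δ s q : ℝ}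
    (hst : s ≤ t) (hb : ∀ z ∈ Metric.closedBall (t, r) δ, z ∈ U ∧
      fderiv ℝ φ z (1, 0) - 2 * (z.1 - t) + ham ℓ (fderiv ℝ φ z (0, 1) - 2 * (z.2 - r)) < 0)
    (hs : |s - t| ≤ δ) (hq : |q * (s - t)| ≤ δ) :
    φ (t, r) ≤ φ (s, r + q * (s - t)) - ((s - t) ^ 2 + (q * (s - t)) ^ 2) + (t - s) * ℓ q := by
  set θ : ℝ → ℝ := fun τ => φ (τ, r + q * (τ - t)) - ((τ - t) ^ 2 + (q * (τ - t)) ^ 2) with hθ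
  have hmem : ∀ τ ∈ Icc s t, (τ, r + q * (τ - t)) ∈ Metric.closedBall (t, r) δ := by
    intro τ hτ
    have h1 : |τ - t| ≤ |s - t| := by
      rw [abs_of_nonpos (by linarith [hτ.2]), abs_of_nonpos (by linarith)]
      linarith [hτ.1]
    refine max_le (h1.trans hs) ?_
    rw [Real.dist_eq]
    simp only [add_sub_cancel_left]
    rw [abs_mul] at hq ⊢
    exact (mul_le_mul_of_nonneg_left h1 (abs_nonneg q)).trans hq
  have hd : ∀ τ ∈ Icc s t, HasDerivAt θ (fderiv ℝ φ (τ, r + q * (τ - t)) (1, q) -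
      (2 * (τ - t) + 2 * q * (q * (τ - t)))) τ := by
    intro τ hτ
    have hz := (hb _ (hmem τ hτ)).1
    have h1 := ((hφ.differentiableOn one_ne_zero).differentiableAt (hU.mem_nhds hz)).hasFDerivAt
    have h2 : HasDerivAt (fun τ : ℝ => τ - t) 1 τ := (hasDerivAt_id τ).sub_const t
    have h3 : HasDerivAt (fun τ : ℝ => (τ, r + q * (τ - t))) (1, q) τ := by
      have := (h2.const_mul q).const_add r
      rw [mul_one] at this
      exact (hasDerivAt_id τ).prodMk this
    have h4 := (h2.pow 2).add ((h2.const_mul q).pow 2)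
    refine ((h1.comp_hasDerivAt τ h3).sub h4).congr_deriv ?_
    push_cast
    ring
  have key := (convex_Icc s t).image_sub_le_mul_sub_of_deriv_le (f := θ) (C := ℓ q)
    (fun τ hτ => (hd τ hτ).continuousAt.continuousWithinAt)
    (fun τ hτ => (hd τ (interior_subset hτ)).differentiableAt.differentiableWithinAt)
    (fun τ hτ => ?_) s ⟨le_rfl, hst⟩ t ⟨hst, le_rfl⟩ hst
  · simp only [hθ, sub_self, mul_zero, add_zero] at key
    linarith
  · have hτ' := interior_subset hτ
    rw [(hd τ hτ').deriv, apply_eq_add_mul]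
    have h1 := (hb _ (hmem τ hτ')).2
    simp only [add_sub_cancel_left] at h1
    have h2 := hℓ.le_ham hγ
      (fderiv ℝ φ (τ, r + q * (τ - t)) (0, 1) - 2 * (q * (τ - t))) q
    linarith

/-- The value function is a viscosity solution on each branch. -/
theorem IsJunctionProblem.isViscositySolution_uoc (h : IsJunctionProblem e L γ u₀) (T : ℝ)
    (i : Fin N) :
    IsViscositySolution (ham (L i)) (Ioo 0 T ×ˢ Ioi 0) (onBranch e i (uoc e L u₀)) := by
  have hU : IsOpen (Ioo 0 T ×ˢ Ioi (0 : ℝ)) := isOpen_Ioo.prod isOpen_Ioi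
  refine ⟨(h.exists_lipschitzOnWith_uoc i).choose_spec.continuousOn.mono
    (prod_mono (fun t ht => ht.1.le) Ioi_subset_Ici_self), fun φ hφ t r htr heq => ?_⟩
  have hdiff : HasFDerivAt φ (fderiv ℝ φ (t, r)) (t, r) :=
    ((hφ.differentiableOn one_ne_zero).differentiableAt (hU.mem_nhds htr)).hasFDerivAt
  have e1 : deriv (fun s => φ (s, r)) t = fderiv ℝ φ (t, r) (1, 0) :=
    deriv_fst_eq (S := univ) hdiff.hasFDerivWithinAt (Eventually.of_forall fun _ => mem_univ _)
  have e2 : deriv (fun ρ => φ (t, ρ)) r = fderiv ℝ φ (t, r) (0, 1) := deriv_snd_eq hdiff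
  rw [e1, e2]
  have ht0 : 0 < t := htr.1.1
  have hr0 : 0 < r := htr.2
  constructor
  · intro hle
    have : ham (L i) (fderiv ℝ φ (t, r) (0, 1)) ≤ -fderiv ℝ φ (t, r) (1, 0) := ciSup_le fun q => by
      have hS := eventually_sub_mem (q := q) htr.1 hr0.le (Or.inl hr0)
      have htend : Tendsto (fun h : ℝ => (t - h, r - q * h)) (𝓝[>] 0) (𝓝 (t, r)) := by
        have : Continuous fun h : ℝ => (t - h, r - q * h) := by fun_prop
        have := this.tendsto 0
        simp only [mul_zero, sub_zero] at this
        exact this.mono_left nhdsWithin_le_nhds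
      have h1 : fderiv ℝ φ (t, r) (1, q) ≤ L i q := by
        refine fderiv_apply_le_of_eventually_le (S := univ) hdiff.hasFDerivWithinAt
          (Eventually.of_forall fun _ => mem_univ _) ?_
        filter_upwards [hS, htend.eventually hle, self_mem_nhdsWithin] with a ha ha2 hpos
        simp only [mem_Ioi] at hpos
        have := h.uoc_le_segment ha.1.1.le (show t - a ≤ t by linarith) i ha.2 hr0.le
          (show r = r - q * a + q * (t - (t - a)) by ring)
        rw [sub_sub_cancel] at this
        simp only [onBranch] at heq ha2
        linarith
      rw [apply_eq_add_mul] at h1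
      linarith
    linarith
  · intro hle
    by_contra! hneg
    obtain ⟨δ, hδ, hb⟩ := exists_closedBall_strict ((h.convex i).continuous_ham h.pos) hU hφ htr
      hneg hle
    have hδt : δ < t := by
      have := (hb (t - δ, r) (by simp [Prod.dist_eq, abs_of_pos hδ, hδ.le])).1.1.1
      simp only at this
      linarith
    have hδr : δ < r := by
      have := (hb (t, r - δ) (by simp [Prod.dist_eq, abs_of_pos hδ, hδ.le])).1.2
      simp only [mem_Ioi] at this
      linarith
    have hJ := smul_mem_junction (e := e) i hr0.le
    -- The gap on the sphere of radius `δ` makes every competitor cost at least `δ ^ 2` more than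
    -- the infimum, which is absurd.
    have hbound : uoc e L u₀ (t, r • e i) + δ ^ 2 ≤ uoc e L u₀ (t, r • e i) := by
      refine (le_isGLB_iff (h.isGLB_uoc ht0.le hJ)).2 fun c hc => ?_
      obtain ⟨X, V, hr, hXt, rfl⟩ := (mem_costs_iff ht0.le hJ).1 hc
      have hρt : coord e i (X t) = r := by
        rw [hXt, coord_smul_self h.norm_eq h.injective i hr0.le]
      obtain ⟨s, hs0, hst, hsδ, hnear⟩ := hr.exists_last_exit hρt hδ hδt.le
      obtain ⟨hXs, -, hcost⟩ := (hr.restrict hs0 hst.le le_rfl).segment_le_cost h.norm_eq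
        h.injective h.pos (h.convex i) hst fun τ hτ => by linarith [(abs_lt.1 (hnear τ hτ)).1]
      set q := (coord e i (X t) - coord e i (X s)) / (t - s) with hq
      have hqs : q * (s - t) = coord e i (X s) - r := by
        have : t - s ≠ 0 := by linarith
        rw [hq, hρt]
        field_simp
        ring
      have hs1 : |s - t| ≤ δ := hsδ ▸ le_max_left _ _
      have hs2 : |coord e i (X s) - r| ≤ δ := hsδ ▸ le_max_right _ _
      have h1 := sub_sq_le_segment h.pos (h.convex i) hU hφ hst.le
        (fun z hz => ⟨(hb z hz).1, (hb z hz).2.2⟩) hs1 (q := q) (by rwa [hqs])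
      rw [hqs, add_sub_cancel] at h1
      have h2 := (hb (s, coord e i (X s)) (max_le hs1 hs2)).2.1
      simp only [onBranch] at heq h2
      rw [← hXs] at h2
      -- The product distance is a maximum, so one of the two squares is already `δ ^ 2`.
      have h3 : δ ^ 2 ≤ (s - t) ^ 2 + (coord e i (X s) - r) ^ 2 := by
        rw [← sq_abs (s - t), ← sq_abs (coord e i (X s) - r)]
        rcases max_choice |s - t| |coord e i (X s) - r| with hm | hm
        · rw [← hsδ, hm]
          linarith [sq_nonneg |coord e i (X s) - r|]
        · rw [← hsδ, hm]
          linarith [sq_nonneg |s - t|]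
      have h4 := h.uoc_le_cost hs0 (hr.restrict le_rfl hs0 hst.le)
      have h5 := intervalIntegral.integral_add_adjacent_intervals
        (hr.restrict le_rfl hs0 hst.le).cost (hr.restrict hs0 hst.le le_rfl).cost
      linarith
    have : 0 < δ ^ 2 := by positivity
    linarith

theorem IsJunctionProblem.isBranchwiseSolution_uoc (h : IsJunctionProblem e L γ u₀) (T : ℝ) :
    IsBranchwiseSolution e L T u₀ (uoc e L u₀) :=
  ⟨h.continuousOn_uoc.mono (prod_mono (fun _ ht => ht.1) le_rfl), fun _ hx => h.uoc_zero hx,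
    h.isViscositySolution_uoc T⟩

end ValueFunctionSolution

end JunctionHJ

theorem theorem1p4 {N : ℕ} (hN : 1 ≤ N)
    (e : Fin N → JunctionHJ.Plane) (he : ∀ i, ‖e i‖ = 1) (hinj : Function.Injective e)
    (L : Fin N → ℝ → ℝ) (γ : ℝ) (hγ : 0 < γ)
    (hL : ∀ i, JunctionHJ.IsUniformlyConvexC2 γ (L i))
    (u₀ : JunctionHJ.Plane → ℝ) (hu₀ : ∃ K, LipschitzOnWith K u₀ (JunctionHJ.junction e))
    (T : ℝ) (hT : 0 < T) :
    -- every branchwise solution is a sub-solution on the junction and lies below `u_oc`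
    (∀ u : ℝ × JunctionHJ.Plane → ℝ, JunctionHJ.IsBranchwiseSolution e L T u₀ u →
      JunctionHJ.IsSubsolution e L T u₀ u ∧
      ∀ t ∈ Set.Ico 0 T, ∀ x ∈ JunctionHJ.junction e,
        u (t, x) ≤ JunctionHJ.uoc e L u₀ (t, x)) ∧
    -- the infimum `u_oc` is a genuine finite one, and `u_oc` is itself a branchwise solution
    (∀ t ∈ Set.Ico 0 T, ∀ x ∈ JunctionHJ.junction e,
      IsGLB (JunctionHJ.costs e L u₀ t x) (JunctionHJ.uoc e L u₀ (t, x))) ∧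
    JunctionHJ.IsBranchwiseSolution e L T u₀ (JunctionHJ.uoc e L u₀) := by
  have h : JunctionHJ.IsJunctionProblem e L γ u₀ := ⟨hN, he, hinj, hγ, hL, hu₀⟩
  exact ⟨fun u hu => ⟨hu.isSubsolution hN hγ hL, fun t ht x hx => hu.le_uoc h ht hx⟩,
    fun t ht x hx => h.isGLB_uoc ht.1 hx, h.isBranchwiseSolution_uoc T⟩
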